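/- **Terms.** Fix sets $\mathcal K_+,\mathcal K_-$ of instructions. With positive variables $x,y,\dots$ and negative variables $\alpha,\beta,\dots$ (both also written $\kappa$), define values $V::=V_+\mid t_-$, positive values $V_+::=x\mid (V,V')\mid\{V\}\mid k_+$, positive terms $t_+::=V_+\mid\mu\alpha.c$, negative terms $t_-::=\alpha\mid\mu(\kappa,\kappa').c\mid\mu\{\kappa\}.c\mid\mu x.c\mid k_-$ and commands $c::=\langle t_+|t_-\rangle=\langle t_-|t_+\rangle$ (up to $\alpha$-equivalence, $k_\pm\in\mathcal K_\pm$). Reductions of commands: $\langle\mu\alpha.c|t_-\rangle\to_\mu c[t_- /\alpha]$, $\langle V_+|\mu x.c\rangle\to_\mu c[V_+/x]$, $\langle\{V\}|\mu\{\kappa\}.c\rangle\to_\beta c[V/\kappa]$, $\langle(V,V')|\mu(\kappa,\kappa').c\rangle\to_\beta c[V/\kappa,V'/\kappa']$ (the last two when the polarities of variables and values match). **Types.** Kinds are $\iota\mid o^+\mid o^-\mid\sigma\to\tau$, with $\iota^\bot=\iota$, $(o^\pm)^\bot=o^\mp$, $(\sigma\to\tau)^\bot=\sigma\to\tau^\bot$.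 Constructors, always well-kinded, are variables $x^\tau:\tau$ and dual variables $(x^\tau)^\bot:\tau^\bot$, $\lambda x^\sigma.T$, $TU$, $\mathbf 0:\iota$, $\mathbf s:\iota\to\iota$, $rec_\tau:\tau\to(\iota\to\tau\to\tau)\to\iota\to\tau$, $rec_\tau^\bot:\tau\to(\iota\to\tau\to\tau)\to\iota\to\tau^\bot$, and formulas: $A\otimes B$, $\downarrow A$ (positive), $A\parr B$, $\uparrow A$ (negative) for formulas $A,B$ of any polarity, and $\forall x^\tau.A$, $\exists x^\tau.A$ (of the polarity of $A$). The involutive negation $T\mapsto T^\bot$ exchanges $x$ and $x^\bot$, $rec_\tau$ and $rec_\tau^\bot$, $\otimes$ and $\parr$, $\downarrow$ and $\uparrow$, $\exists$ and $\forall$, fixes $\mathbf 0,\mathbf s$, and satisfies $(\lambda x.T)^\bot=\lambda x.T^\bot$, $(TU)^\bot=T^\bot U$; substituting $U$ for $x$ replaces $x^\bot$ by $U^\bot$. Convertibility $\cong$ is the congruence generated by $\beta$, $\eta$, $rec_\tau TU\mathbf 0\cong T$, $rec_\tau TU(\mathbf sn)\cong Un(rec_\tau TUn)$, $rec^\bot_\tau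 TU\mathbf 0\cong T^\bot$, $rec^\bot_\tau TU(\mathbf sn)\cong U^\bot n(rec_\tau TUn)$. **Typing.** A context $\Gamma$ is a finite set of declarations $x:N$ ($N$ negative) and $\alpha:P$ ($P$ positive) of distinct variables. Judgments are $c:(\vdash\Gamma)$ and $\vdash t:A\mid\Gamma$ with $t,A$ of the same polarity and the free variables of $c$, $t$ declared in $\Gamma$. The rules $R$ of MAL$\omega$ are, where $\Gamma,\Delta$ declare disjoint sets of variables and listed variables are distinct and not in $\Gamma$: - $(Ax_+)$ $\vdash x:P\mid x:P^\bot$; $(Ax_-)$ $\vdash\alpha:N\mid\alpha:N^\bot$; - $(\mu_+)$ from $c:(\vdash\alpha:P,\Gamma)$ infer $\vdash\mu\alpha.c:P\mid\Gamma$; $(\mu_-)$ from $c:(\vdash x:N,\Gamma)$ infer $\vdash\mu x.c:N\mid\Gamma$; - $(Cut)$ from $\vdash t:A\mid\Gamma$ and $\vdash u:A^\bot\mid\Delta$ infer $\langle t|u\rangle:(\vdash\Gamma,\Delta)$; - $(\otimes)$ from $\vdash V:A\mid\Gamma$ and $\vdash V':B\mid\Delta$ infer $\vdash(V,V'):A\otimes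 B\mid\Gamma,\Delta$; $(\parr)$ from $c:(\vdash\kappa:A,\kappa':B,\Gamma)$ infer $\vdash\mu(\kappa,\kappa').c:A\parr B\mid\Gamma$; - $(\downarrow)$ from $\vdash V:A\mid\Gamma$ infer $\vdash\{V\}:{\downarrow}A\mid\Gamma$; $(\uparrow)$ from $c:(\vdash\kappa:A,\Gamma)$ infer $\vdash\mu\{\kappa\}.c:{\uparrow}A\mid\Gamma$; - $(\exists)$ from $\vdash t:A[T/x^\tau]\mid\Gamma$ with $T:\tau$ infer $\vdash t:\exists x^\tau.A\mid\Gamma$; $(\forall)$ from $\vdash V:A\mid\Gamma$ with $x^\tau$ not in $\Gamma$ infer $\vdash V:\forall x^\tau.A\mid\Gamma$; - $(\cong)$ from $c:(\vdash\kappa:A,\Gamma)$ and $A\cong B$ infer $c:(\vdash\kappa:B,\Gamma)$; $(W)$ from $c:(\vdash\Gamma)$ infer $c:(\vdash\kappa:A,\Gamma)$. **Poles.** A quantitative monoid $\mathcal M$ is a commutative monoid with a preorder compatible with $+$ such that $\mathbf 0\le p$ for all $p$, and a monotone map $\|\cdot\|:\mathcal M\to\mathbb N$ with $\|p\|+\|q\|\le\|p+q\|$.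 A saturated quantitative pole is $(\mathcal M,\bot\!\!\!\bot,p_\beta)$ with $p_\beta\in\mathcal M$ and $\bot\!\!\!\bot$ a set of pairs (closed command, element of $\mathcal M$) such that, for closed $c$: if $c\to_\beta c'$ and $(c',p)\in\bot\!\!\!\bot$ then $(c,p+p_\beta)\in\bot\!\!\!\bot$; if $c\to_\mu c'$ then $(c,p)\in\bot\!\!\!\bot\Leftrightarrow(c',p)\in\bot\!\!\!\bot$; if $p\le p'$ and $(c,p)\in\bot\!\!\!\bot$ then $(c,p')\in\bot\!\!\!\bot$. For a set $X$ of weighted (i.e. paired with an element of $\mathcal M$) closed terms of one polarity, $X^\bot$ is the set of the weighted closed terms $(u,q)$ of the other polarity with $(\langle t|u\rangle,p+q)\in\bot\!\!\!\bot$ for all $(t,p)\in X$. Put $\overline X=\{(t,q):\exists p\le q,\ (t,p)\in X\}$, $X\otimes Y=\{((t,u),p+q):(t,p)\in X,(u,q)\in Y\}$, ${\downarrow}X=\{(\{t\},p):(t,p)\in X\}$. **Interpretation.** A positive propositional domain is a non-empty set $\mathcal D^\oplus$ of sets of weighted closed positive values, closed under unions and intersections of non-empty families, and containing $X\otimes Y$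 and ${\downarrow}X$ for all $X,Y\in\mathcal D^\oplus\cup\mathcal D^\ominus$, where $\mathcal D^\ominus=\{X^\bot:X\in\mathcal D^\oplus\}$. Kinds are interpreted by $[\![\iota]\!]=\mathbb N$, $[\![o^+]\!]=\mathcal D^\oplus$, $[\![o^-]\!]=\mathcal D^\ominus$, where an element $X^\bot$ of $[\![o^-]\!]$ is given together with $X\in\mathcal D^\oplus$, and $[\![\sigma\to\tau]\!]=[\![\tau]\!]^{[\![\sigma]\!]}$; orthogonality exchanges $X\in[\![o^+]\!]$ and $X^\bot\in[\![o^-]\!]$, is the identity on $\mathbb N$ and acts pointwise on functions. For a valuation $\rho$ (an element of $[\![\tau]\!]$ for every variable $x^\tau$), $[\![T]\!]_\rho$ is defined by $[\![x]\!]_\rho=\rho(x)$; $[\![x^\bot]\!]_\rho$ is the orthogonal of $\rho(x)$; $\lambda$, application, $\mathbf 0$, $\mathbf s$, $rec_\tau$ have their usual meaning and $rec_\tau^\bot$ means the orthogonal of $rec_\tau$; $[\![A\otimes B]\!]_\rho=[\![A]\!]_\rho\otimes[\![B]\!]_\rho$, $[\![\downarrow A]\!]_\rho={\downarrow}[\![A]\!]_\rho$,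 $[\![A\parr B]\!]_\rho=([\![A^\bot]\!]_\rho\otimes[\![B^\bot]\!]_\rho)^\bot$, $[\![\uparrow A]\!]_\rho=({\downarrow}[\![A^\bot]\!]_\rho)^\bot$; for positive $P$, $[\![\exists x^\sigma.P]\!]_\rho$ and $[\![\forall x^\sigma.P]\!]_\rho$ are the union and the intersection of the sets $[\![P]\!]_{\rho[x\leftarrow v]}$, $v\in[\![\sigma]\!]$; for negative $N$, $[\![\exists x^\sigma.N]\!]_\rho=[\![\forall x^\sigma.N^\bot]\!]_\rho^\bot$ and $[\![\forall x^\sigma.N]\!]_\rho=[\![\exists x^\sigma.N^\bot]\!]_\rho^\bot$. **Adequacy.** A substitution $\sigma=[\kappa_i\leftarrow(V_i,p_i)]_{i\le n}$ is adequate to $\Gamma[\rho]$, $\Gamma=\kappa_1:A_1,\dots,\kappa_n:A_n$, if $(V_i,p_i)\in[\![A_i^\bot]\!]_\rho$ for all $i$; write $(e,p)[\sigma]=(e[V_1/\kappa_1,\dots,V_n/\kappa_n],p+\sum_ip_i)$. For $p\in\mathcal M$, the judgment $c:(\vdash\Gamma)$ is $p$-adequate if $(c,p)[\sigma]\in\bot\!\!\!\bot$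 for all $\rho$ and all $\sigma$ adequate to $\Gamma[\rho]$; the judgment $\vdash t:B\mid\Gamma$ is $p$-adequate if for all such $\rho,\sigma$ we have $(t,p)[\sigma]\in[\![B]\!]_\rho^{\bot\bot}$ and, when $t$ is a value, $(t,p)[\sigma]\in\overline{[\![B]\!]_\rho}$. It is strictly $p$-adequate if the last condition holds with $[\![B]\!]_\rho$ in place of $\overline{[\![B]\!]_\rho}$ (for commands the two notions agree). Strict $p$-adequacy implies $p$-adequacy. An instance of a rule with premises $J_1,\dots,J_n$ and conclusion $L$ is (strictly) $f$-adequate, $f:\mathcal M^n\to\mathcal M$, if for all $p_1,\dots,p_n\in\mathcal M$: whenever each $J_i$ is (strictly) $p_i$-adequate, $L$ is (strictly) $f(p_1,\dots,p_n)$-adequate. Put $M(Ax_+)=M(Ax_-)=\mathbf 0$, $M(Cut)=M(\otimes)=(x,y)\mapsto x+y$, $M(\parr)=M(\uparrow)=x\mapsto x+p_\beta$, and $M(R)=x\mapsto x$ for the other rules $\mu_+,\mu_-,\downarrow,\exists,\forall,\cong,W$. For a derivation $\pi$, $M(\pi)\in\mathcal M$ is obtained by composing the functions of its rules. **Theorem.**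 Let $(\mathcal M,\bot\!\!\!\bot,p_\beta)$ be a saturated quantitative pole and $\mathcal D^\oplus$ a positive propositional domain. Then 1. every instance of every rule $R$ of MAL$\omega$ is $M(R)$-adequate, where for instances of $(\forall)$ with $A$ positive it is assumed that every $X\in\mathcal D^\oplus$ satisfies $\overline X=X$; 2. every instance of every rule $R$ of MAL$\omega$, without exception, is strictly $M(R)$-adequate; 3. the conclusion of every derivation $\pi$ of MAL$\omega$ is $M(\pi)$-adequate, and even strictly $M(\pi)$-adequate. -/

import Mathlib

universe u v

namespace MALomega

/-! ## Polarities, variables -/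

/-- Polarities of terms, term variables and formulas. -/
inductive Pol
  | pos
  | neg
  deriving DecidableEq

def Pol.dual : Pol → Pol
  | .pos => .neg
  | .neg => .pos

theorem Pol.dual_dual : ∀ p : Pol, p.dual.dual = p
  | .pos => rfl
  | .neg => rfl

/-- `Ix l a`: a position in the list `l` at which `a` stands (a well-scoped de Bruijn index). -/
inductive Ix {α : Type} : List α → α → Type
  | zero {l : List α} {a : α} : Ix (a :: l) a
  | succ {l : List α} {a b : α} : Ix l a → Ix (b :: l) a

/-! ## Terms of the calculus

Bound variables are de Bruijn indices and free variables are names, so that terms are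
automatically taken modulo renaming of bound variables. -/

/-- Term variables: the positive variables `x, y, …` and the negative variables `α, β, …`. -/
structure TVar where
  pol : Pol
  idx : ℕ
  deriving DecidableEq

/-- Syntactic categories: `val pos` are the positive values, `val neg` the negative terms
(all of which are values), `pterm` the positive terms, and `cmd` the commands. -/
inductive Cat
  | val (p : Pol)
  | pterm
  | cmd

/-- The expressions with bound variables in `Δ`; `K pos` and `K neg` are the sets of positive
and negative instructions. Commands have only the form `⟨t₊ | t₋⟩`, which realizes the
identification of `⟨t | u⟩` and `⟨u | t⟩`. -/
inductive Exp (K : Pol → Type u) : List Pol → Cat → Type u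
  | bvar {Δ : List Pol} {p : Pol} (i : Ix Δ p) : Exp K Δ (.val p)
  | fvar {Δ : List Pol} {p : Pol} (n : ℕ) : Exp K Δ (.val p)
  /-- an instruction `k₊` or `k₋` -/
  | instr {Δ : List Pol} {p : Pol} (k : K p) : Exp K Δ (.val p)
  /-- `(V, V')` -/
  | pair {Δ : List Pol} {p q : Pol} (V : Exp K Δ (.val p)) (V' : Exp K Δ (.val q)) :
      Exp K Δ (.val .pos)
  /-- `{V}` -/
  | box {Δ : List Pol} {p : Pol} (V : Exp K Δ (.val p)) : Exp K Δ (.val .pos)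
  /-- `μ(κ,κ').c` -/
  | muPair {Δ : List Pol} {p q : Pol} (c : Exp K (p :: q :: Δ) .cmd) : Exp K Δ (.val .neg)
  /-- `μ{κ}.c` -/
  | muBox {Δ : List Pol} {p : Pol} (c : Exp K (p :: Δ) .cmd) : Exp K Δ (.val .neg)
  /-- `μx.c` -/
  | muNeg {Δ : List Pol} (c : Exp K (.pos :: Δ) .cmd) : Exp K Δ (.val .neg)
  /-- a positive value, as a positive term -/
  | ret {Δ : List Pol} (V : Exp K Δ (.val .pos)) : Exp K Δ .pterm
  /-- `μα.c` -/
  | muPos {Δ : List Pol} (c : Exp K (.neg :: Δ) .cmd) : Exp K Δ .pterm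
  /-- `⟨t₊ | t₋⟩` -/
  | cut {Δ : List Pol} (t : Exp K Δ .pterm) (u : Exp K Δ (.val .neg)) : Exp K Δ .cmd

/-- Category of the terms of polarity `p`. -/
def tmCat : Pol → Cat
  | .pos => .pterm
  | .neg => .val .neg

/-- Values of polarity `p`. -/
abbrev Val (K : Pol → Type u) (p : Pol) : Type u := Exp K [] (.val p)

/-- Terms of polarity `p`. -/
abbrev Tm (K : Pol → Type u) (p : Pol) : Type u := Exp K [] (tmCat p)

/-- Commands. -/
abbrev Cmd (K : Pol → Type u) : Type u := Exp K [] .cmd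

/-- A value, as a term of the same polarity. -/
def Val.toTm {K : Pol → Type u} : {p : Pol} → Val K p → Tm K p
  | .pos, V => Exp.ret V
  | .neg, V => V

/-- The command formed by two terms of opposite polarities, whatever the order. -/
def com {K : Pol → Type u} : {p : Pol} → Tm K p → Tm K p.dual → Cmd K
  | .pos, t, u => Exp.cut t u
  | .neg, t, u => Exp.cut u t

/-- A free variable, as a value. -/
def fv {K : Pol → Type u} {Δ : List Pol} (x : TVar) : Exp K Δ (.val x.pol) := .fvar x.idx

/-- The set `FV(e)` of the free variables. -/
def Exp.FV {K : Pol → Type u} : {Δ : List Pol} → {c : Cat} → Exp K Δ c → Set TVar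
  | _, _, .bvar _ => ∅
  | _, _, .fvar (p := p) n => {⟨p, n⟩}
  | _, _, .instr _ => ∅
  | _, _, .pair V V' => V.FV ∪ V'.FV
  | _, _, .box V => V.FV
  | _, _, .muPair c => c.FV
  | _, _, .muBox c => c.FV
  | _, _, .muNeg c => c.FV
  | _, _, .ret V => V.FV
  | _, _, .muPos c => c.FV
  | _, _, .cut t u => t.FV ∪ u.FV

def Exp.Closed {K : Pol → Type u} {Δ : List Pol} {c : Cat} (e : Exp K Δ c) : Prop := e.FV = ∅

/-- Extension of a renaming of bound variables under a binder. -/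
def liftRen {α : Type} {l l' : List α} {b : α} (r : ∀ a, Ix l a → Ix l' a) :
    ∀ a, Ix (b :: l) a → Ix (b :: l') a
  | _, .zero => .zero
  | _, .succ i => .succ (r _ i)

/-- Renaming of the bound variables. -/
def Exp.ren {K : Pol → Type u} : {Δ Δ' : List Pol} → {c : Cat} →
    (∀ p, Ix Δ p → Ix Δ' p) → Exp K Δ c → Exp K Δ' c
  | _, _, _, r, .bvar i => .bvar (r _ i)
  | _, _, _, _, .fvar n => .fvar n
  | _, _, _, _, .instr k => .instr k
  | _, _, _, r, .pair V V' => .pair (V.ren r) (V'.ren r)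
  | _, _, _, r, .box V => .box (V.ren r)
  | _, _, _, r, .muPair c => .muPair (c.ren (liftRen (liftRen r)))
  | _, _, _, r, .muBox c => .muBox (c.ren (liftRen r))
  | _, _, _, r, .muNeg c => .muNeg (c.ren (liftRen r))
  | _, _, _, r, .ret V => .ret (V.ren r)
  | _, _, _, r, .muPos c => .muPos (c.ren (liftRen r))
  | _, _, _, r, .cut t u => .cut (t.ren r) (u.ren r)

/-- Weakening by one bound variable. -/
def Exp.wk {K : Pol → Type u} {Δ : List Pol} {q : Pol} {c : Cat} (e : Exp K Δ c) :
    Exp K (q :: Δ) c :=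
  e.ren fun _ i => .succ i

/-- Extension under a binder of an assignment of values to the bound variables. -/
def liftB {K : Pol → Type u} {Δ Δ' : List Pol} {q : Pol}
    (b : ∀ p, Ix Δ p → Exp K Δ' (.val p)) : ∀ p, Ix (q :: Δ) p → Exp K (q :: Δ') (.val p)
  | _, .zero => .bvar .zero
  | _, .succ i => (b _ i).wk

/-- Extension under a binder of an assignment of values to the free variables. -/
def liftF {K : Pol → Type u} {Δ' : List Pol} {q : Pol}
    (f : ∀ x : TVar, Exp K Δ' (.val x.pol)) : ∀ x : TVar, Exp K (q :: Δ') (.val x.pol) :=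
  fun x => (f x).wk

/-- Simultaneous capture-avoiding substitution: `b` for the bound variables and `f` for the
free variables. -/
def Exp.bind {K : Pol → Type u} : {Δ Δ' : List Pol} → {c : Cat} →
    (∀ p, Ix Δ p → Exp K Δ' (.val p)) → (∀ x : TVar, Exp K Δ' (.val x.pol)) →
    Exp K Δ c → Exp K Δ' c
  | _, _, _, b, _, .bvar i => b _ i
  | _, _, _, _, f, .fvar (p := p) n => f ⟨p, n⟩
  | _, _, _, _, _, .instr k => .instr k
  | _, _, _, b, f, .pair V V' => .pair (V.bind b f) (V'.bind b f)
  | _, _, _, b, f, .box V => .box (V.bind b f)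
  | _, _, _, b, f, .muPair c => .muPair (c.bind (liftB (liftB b)) (liftF (liftF f)))
  | _, _, _, b, f, .muBox c => .muBox (c.bind (liftB b) (liftF f))
  | _, _, _, b, f, .muNeg c => .muNeg (c.bind (liftB b) (liftF f))
  | _, _, _, b, f, .ret V => .ret (V.bind b f)
  | _, _, _, b, f, .muPos c => .muPos (c.bind (liftB b) (liftF f))
  | _, _, _, b, f, .cut t u => .cut (t.bind b f) (u.bind b f)

/-- The empty assignment of values. -/
def noB {K : Pol → Type u} {Δ' : List Pol} : ∀ q, Ix [] q → Exp K Δ' (.val q) :=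
  fun _ i => nomatch i

def oneB {K : Pol → Type u} {p : Pol} (V : Val K p) : ∀ q, Ix [p] q → Val K q
  | _, .zero => V

def twoB {K : Pol → Type u} {p q : Pol} (V : Val K p) (V' : Val K q) :
    ∀ r, Ix [p, q] r → Val K r
  | _, .zero => V
  | _, .succ .zero => V'

/-- `c[V/κ]` where `κ` is the only bound variable of `c`. -/
def Exp.inst {K : Pol → Type u} {p : Pol} {a : Cat} (c : Exp K [p] a) (V : Val K p) :
    Exp K [] a :=
  c.bind (oneB V) fv

/-- `c[V/κ, V'/κ']` where `κ, κ'` are the bound variables of `c`. -/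
def Exp.inst₂ {K : Pol → Type u} {p q : Pol} {a : Cat} (c : Exp K [p, q] a)
    (V : Val K p) (V' : Val K q) : Exp K [] a :=
  c.bind (twoB V V') fv

/-- Turning the free variable `κ` into a bound variable (the scope of a binder `μκ.`). -/
def Exp.close {K : Pol → Type u} (κ : TVar) {a : Cat} (c : Exp K [] a) : Exp K [κ.pol] a :=
  c.bind noB (fun x => if h : x = κ then h ▸ .bvar .zero else fv x)

/-- Turning the free variables `κ, κ'` into bound variables (the scope of a binder
`μ(κ,κ').`). -/
def Exp.close₂ {K : Pol → Type u} (κ κ' : TVar) {a : Cat} (c : Exp K [] a) :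
    Exp K [κ.pol, κ'.pol] a :=
  c.bind noB
    (fun x => if h : x = κ then h ▸ .bvar .zero
      else if h' : x = κ' then h' ▸ .bvar (.succ .zero) else fv x)

/-! ## Reduction -/

/-- The reduction `→_μ`. -/
inductive RedMu {K : Pol → Type u} : Cmd K → Cmd K → Prop
  | pos (c : Exp K [.neg] .cmd) (t : Val K .neg) : RedMu (.cut (.muPos c) t) (c.inst t)
  | neg (V : Val K .pos) (c : Exp K [.pos] .cmd) : RedMu (.cut (.ret V) (.muNeg c)) (c.inst V)

/-- The reduction `→_β`, defined only when the polarities of variables and values match. -/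
inductive RedBeta {K : Pol → Type u} : Cmd K → Cmd K → Prop
  | up {p : Pol} (V : Val K p) (c : Exp K [p] .cmd) :
      RedBeta (.cut (.ret (.box V)) (.muBox c)) (c.inst V)
  | par {p q : Pol} (V : Val K p) (V' : Val K q) (c : Exp K [p, q] .cmd) :
      RedBeta (.cut (.ret (.pair V V')) (.muPair c)) (c.inst₂ V V')

/-! ## Kinds and constructors -/

inductive Kind
  | iota
  | o (p : Pol)
  | arr (σ τ : Kind)

/-- Negation of kinds. -/
def Kind.dual : Kind → Kind
  | .iota => .iota
  | .o p => .o p.dual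
  | .arr σ τ => .arr σ τ.dual

theorem Kind.dual_dual : ∀ κ : Kind, κ.dual.dual = κ
  | .iota => rfl
  | .o p => congrArg Kind.o p.dual_dual
  | .arr σ τ => congrArg (Kind.arr σ) τ.dual_dual

/-- The constructors of kind `κ` whose free variables are in the list `Θ` of kinds. Every
variable `x` of kind `τ` gives two atoms: `x` (of kind `τ`) and `x^⊥` (of kind `τ^⊥`). -/
inductive Con : List Kind → Kind → Type
  | var {Θ : List Kind} {τ : Kind} (x : Ix Θ τ) : Con Θ τ
  | nvar {Θ : List Kind} {τ : Kind} (x : Ix Θ τ) : Con Θ τ.dual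
  | lam {Θ : List Kind} {σ τ : Kind} (T : Con (σ :: Θ) τ) : Con Θ (.arr σ τ)
  | app {Θ : List Kind} {σ τ : Kind} (T : Con Θ (.arr σ τ)) (U : Con Θ σ) : Con Θ τ
  | zero {Θ : List Kind} : Con Θ .iota
  | succ {Θ : List Kind} : Con Θ (.arr .iota .iota)
  /-- the recursor `rec_τ` -/
  | recN {Θ : List Kind} (τ : Kind) :
      Con Θ (.arr τ (.arr (.arr .iota (.arr τ τ)) (.arr .iota τ)))
  /-- the dual recursor `rec_τ^⊥` -/
  | recD {Θ : List Kind} (τ : Kind) :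
      Con Θ (.arr τ (.arr (.arr .iota (.arr τ τ)) (.arr .iota τ.dual)))
  | tensor {Θ : List Kind} {p q : Pol} (A : Con Θ (.o p)) (B : Con Θ (.o q)) : Con Θ (.o .pos)
  | par {Θ : List Kind} {p q : Pol} (A : Con Θ (.o p)) (B : Con Θ (.o q)) : Con Θ (.o .neg)
  | ex {Θ : List Kind} {p : Pol} (σ : Kind) (A : Con (σ :: Θ) (.o p)) : Con Θ (.o p)
  | all {Θ : List Kind} {p : Pol} (σ : Kind) (A : Con (σ :: Θ) (.o p)) : Con Θ (.o p)
  | down {Θ : List Kind} {p : Pol} (A : Con Θ (.o p)) : Con Θ (.o .pos)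
  | up {Θ : List Kind} {p : Pol} (A : Con Θ (.o p)) : Con Θ (.o .neg)

/-- Formulas of polarity `p`. -/
abbrev Form (Θ : List Kind) (p : Pol) : Type := Con Θ (.o p)

/-- The involutive negation `T^⊥`. -/
def Con.neg : {Θ : List Kind} → {κ : Kind} → Con Θ κ → Con Θ κ.dual
  | _, _, .var x => .nvar x
  | _, _, .nvar (τ := τ) x => τ.dual_dual.symm ▸ .var x
  | _, _, .lam T => .lam T.neg
  | _, _, .app T U => .app T.neg U
  | _, _, .zero => .zero
  | _, _, .succ => .succ
  | _, _, .recN τ => .recD τ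
  | Θ, _, .recD τ =>
      (congrArg (fun κ => Con Θ (.arr τ (.arr (.arr .iota (.arr τ τ)) (.arr .iota κ))))
        τ.dual_dual.symm).mp (.recN τ)
  | _, _, .tensor A B => .par A.neg B.neg
  | _, _, .par A B => .tensor A.neg B.neg
  | _, _, .ex σ A => .all σ A.neg
  | _, _, .all σ A => .ex σ A.neg
  | _, _, .down A => .up A.neg
  | _, _, .up A => .down A.neg

/-- The negation of a formula. -/
def Form.neg {Θ : List Kind} {p : Pol} (A : Form Θ p) : Form Θ p.dual := Con.neg A

/-- Renaming of variables in constructors. -/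
def Con.ren : {Θ Θ' : List Kind} → {κ : Kind} → (∀ τ, Ix Θ τ → Ix Θ' τ) → Con Θ κ → Con Θ' κ
  | _, _, _, r, .var x => .var (r _ x)
  | _, _, _, r, .nvar x => .nvar (r _ x)
  | _, _, _, r, .lam T => .lam (T.ren (liftRen r))
  | _, _, _, r, .app T U => .app (T.ren r) (U.ren r)
  | _, _, _, _, .zero => .zero
  | _, _, _, _, .succ => .succ
  | _, _, _, _, .recN τ => .recN τ
  | _, _, _, _, .recD τ => .recD τ
  | _, _, _, r, .tensor A B => .tensor (A.ren r) (B.ren r)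
  | _, _, _, r, .par A B => .par (A.ren r) (B.ren r)
  | _, _, _, r, .ex σ A => .ex σ (A.ren (liftRen r))
  | _, _, _, r, .all σ A => .all σ (A.ren (liftRen r))
  | _, _, _, r, .down A => .down (A.ren r)
  | _, _, _, r, .up A => .up (A.ren r)

/-- Weakening by one (fresh) variable of kind `σ`. -/
def Con.wk {Θ : List Kind} {σ κ : Kind} (T : Con Θ κ) : Con (σ :: Θ) κ :=
  T.ren fun _ x => .succ x

def liftS {Θ Θ' : List Kind} {σ : Kind} (s : ∀ τ, Ix Θ τ → Con Θ' τ) :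
    ∀ τ, Ix (σ :: Θ) τ → Con (σ :: Θ') τ
  | _, .zero => .var .zero
  | _, .succ x => (s _ x).wk

/-- Simultaneous substitution in constructors; the dual atom `x^⊥` is replaced by the negation
of what replaces `x`. -/
def Con.subst : {Θ Θ' : List Kind} → {κ : Kind} → (∀ τ, Ix Θ τ → Con Θ' τ) →
    Con Θ κ → Con Θ' κ
  | _, _, _, s, .var x => s _ x
  | _, _, _, s, .nvar x => (s _ x).neg
  | _, _, _, s, .lam T => .lam (T.subst (liftS s))
  | _, _, _, s, .app T U => .app (T.subst s) (U.subst s)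
  | _, _, _, _, .zero => .zero
  | _, _, _, _, .succ => .succ
  | _, _, _, _, .recN τ => .recN τ
  | _, _, _, _, .recD τ => .recD τ
  | _, _, _, s, .tensor A B => .tensor (A.subst s) (B.subst s)
  | _, _, _, s, .par A B => .par (A.subst s) (B.subst s)
  | _, _, _, s, .ex σ A => .ex σ (A.subst (liftS s))
  | _, _, _, s, .all σ A => .all σ (A.subst (liftS s))
  | _, _, _, s, .down A => .down (A.subst s)
  | _, _, _, s, .up A => .up (A.subst s)

/-- The substitution of `U` for the variable `0`. -/
def sub₀ {Θ : List Kind} {σ : Kind} (U : Con Θ σ) : ∀ τ, Ix (σ :: Θ) τ → Con Θ τ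
  | _, .zero => U
  | _, .succ x => .var x

/-- `T[U/x]`, where `x` is the variable `0`. -/
def Con.subst₀ {Θ : List Kind} {σ κ : Kind} (T : Con (σ :: Θ) κ) (U : Con Θ σ) : Con Θ κ :=
  T.subst (sub₀ U)

/-- The convertibility relation `T ≅ T'`. -/
inductive Conv : {Θ : List Kind} → {κ : Kind} → Con Θ κ → Con Θ κ → Prop
  | beta {Θ : List Kind} {σ τ : Kind} (T : Con (σ :: Θ) τ) (U : Con Θ σ) :
      Conv (.app (.lam T) U) (T.subst₀ U)
  | eta {Θ : List Kind} {σ τ : Kind} (T : Con Θ (.arr σ τ)) :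
      Conv (.lam (.app T.wk (.var .zero))) T
  | recN_zero {Θ : List Kind} {τ : Kind} (T : Con Θ τ)
      (U : Con Θ (.arr .iota (.arr τ τ))) :
      Conv (.app (.app (.app (.recN τ) T) U) .zero) T
  | recN_succ {Θ : List Kind} {τ : Kind} (T : Con Θ τ)
      (U : Con Θ (.arr .iota (.arr τ τ))) (n : Con Θ .iota) :
      Conv (.app (.app (.app (.recN τ) T) U) (.app .succ n))
        (.app (.app U n) (.app (.app (.app (.recN τ) T) U) n))
  | recD_zero {Θ : List Kind} {τ : Kind} (T : Con Θ τ)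
      (U : Con Θ (.arr .iota (.arr τ τ))) :
      Conv (.app (.app (.app (.recD τ) T) U) .zero) T.neg
  | recD_succ {Θ : List Kind} {τ : Kind} (T : Con Θ τ)
      (U : Con Θ (.arr .iota (.arr τ τ))) (n : Con Θ .iota) :
      Conv (.app (.app (.app (.recD τ) T) U) (.app .succ n))
        (.app (.app U.neg n) (.app (.app (.app (.recN τ) T) U) n))
  | refl {Θ : List Kind} {κ : Kind} (T : Con Θ κ) : Conv T T
  | symm {Θ : List Kind} {κ : Kind} {T T' : Con Θ κ} : Conv T T' → Conv T' T
  | trans {Θ : List Kind} {κ : Kind} {T T' T'' : Con Θ κ} :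
      Conv T T' → Conv T' T'' → Conv T T''
  | lam {Θ : List Kind} {σ τ : Kind} {T T' : Con (σ :: Θ) τ} :
      Conv T T' → Conv (.lam T) (.lam T')
  | app {Θ : List Kind} {σ τ : Kind} {T T' : Con Θ (.arr σ τ)} {U U' : Con Θ σ} :
      Conv T T' → Conv U U' → Conv (.app T U) (.app T' U')
  | tensor {Θ : List Kind} {p q : Pol} {A A' : Form Θ p} {B B' : Form Θ q} :
      Conv A A' → Conv B B' → Conv (.tensor A B) (.tensor A' B')
  | par {Θ : List Kind} {p q : Pol} {A A' : Form Θ p} {B B' : Form Θ q} :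
      Conv A A' → Conv B B' → Conv (.par A B) (.par A' B')
  | ex {Θ : List Kind} {σ : Kind} {p : Pol} {A A' : Form (σ :: Θ) p} :
      Conv A A' → Conv (.ex σ A) (.ex σ A')
  | all {Θ : List Kind} {σ : Kind} {p : Pol} {A A' : Form (σ :: Θ) p} :
      Conv A A' → Conv (.all σ A) (.all σ A')
  | down {Θ : List Kind} {p : Pol} {A A' : Form Θ p} : Conv A A' → Conv (.down A) (.down A')
  | up {Θ : List Kind} {p : Pol} {A A' : Form Θ p} : Conv A A' → Conv (.up A) (.up A')

/-! ## Finite partial functions on term variables -/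

/-- A finite partial function on the term variables. -/
@[ext] structure FMap (β : TVar → Type v) where
  toFun : ∀ x : TVar, Option (β x)
  finite : {x | (toFun x).isSome}.Finite

namespace FMap

variable {β : TVar → Type v}

/-- The domain. -/
noncomputable def dom (f : FMap β) : Finset TVar := f.finite.toFinset

def empty : FMap β := ⟨fun _ => none, by simp⟩

/-- `κ : a, f` (only used when `κ` is not in the domain of `f`). -/
def cons (f : FMap β) (κ : TVar) (a : β κ) : FMap β where
  toFun := Function.update f.toFun κ (some a)
  finite := by
    refine (f.finite.insert κ).subset fun x hx => ?_
    by_cases h : x = κ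
    · exact Or.inl h
    · right
      simpa [Function.update_of_ne h] using hx

/-- The union `f, g` (only used when the domains are disjoint). -/
def union (f g : FMap β) : FMap β where
  toFun x := (f.toFun x).or (g.toFun x)
  finite := by
    refine (f.finite.union g.finite).subset fun x hx => ?_
    simpa [Option.isSome_or] using hx

/-- The entrywise image. -/
def map {γ : TVar → Type v} (h : ∀ x, β x → γ x) (f : FMap β) : FMap γ where
  toFun x := (f.toFun x).map (h x)
  finite := f.finite.subset fun x hx => by simpa using hx

end FMap

/-! ## Typing -/

/-- Typing contexts: positive variables are declared with negative formulas and negative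
variables with positive formulas. -/
abbrev Ctx (Θ : List Kind) : Type := FMap fun x => Form Θ x.pol.dual

/-- Weakening of a context by a constructor variable; it expresses that the new variable does
not appear in the context. -/
def Ctx.wk {Θ : List Kind} {σ : Kind} (Γ : Ctx Θ) : Ctx (σ :: Θ) := FMap.map (fun _ A => Con.wk A) Γ

/-- Typing judgments `c : (⊢ Γ)` and `⊢ t : A | Γ` (with `t` and `A` of the same polarity), with
constructor variables in `Θ`. -/
inductive Judgment (K : Pol → Type u) : Type u
  | cmd (Θ : List Kind) (c : Cmd K) (Γ : Ctx Θ)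
  | tm (Θ : List Kind) (p : Pol) (t : Tm K p) (A : Form Θ p) (Γ : Ctx Θ)

/-- The free variables of the subject are declared in the context. -/
def Judgment.Scoped {K : Pol → Type u} : Judgment K → Prop
  | .cmd _ c Γ => c.FV ⊆ Γ.dom
  | .tm _ _ t _ Γ => t.FV ⊆ Γ.dom

/-- The names of the typing rules. -/
inductive RuleName
  | axPos | axNeg | muPos | muNeg | cut | tensor | par | down | up | ex | all | conv | weak

/-- The number of premises. -/
def RuleName.arity : RuleName → ℕ
  | .axPos | .axNeg => 0
  | .cut | .tensor => 2
  | _ => 1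

/-- `Rule R J L`: from the premises `J` the rule `R` infers the conclusion `L`. -/
inductive Rule {K : Pol → Type u} :
    (R : RuleName) → (Fin R.arity → Judgment K) → Judgment K → Prop
  | axPos {Θ : List Kind} (n : ℕ) (P : Form Θ .pos) :
      Rule .axPos ![] (.tm Θ .pos (.ret (fv ⟨.pos, n⟩)) P (FMap.empty.cons ⟨.pos, n⟩ P.neg))
  | axNeg {Θ : List Kind} (n : ℕ) (N : Form Θ .neg) :
      Rule .axNeg ![] (.tm Θ .neg (fv ⟨.neg, n⟩) N (FMap.empty.cons ⟨.neg, n⟩ N.neg))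
  | muPos {Θ : List Kind} (n : ℕ) (c : Cmd K) (P : Form Θ .pos) (Γ : Ctx Θ)
      (hn : ⟨.neg, n⟩ ∉ Γ.dom) :
      Rule .muPos ![.cmd Θ c (Γ.cons ⟨.neg, n⟩ P)]
        (.tm Θ .pos (.muPos (c.close ⟨.neg, n⟩)) P Γ)
  | muNeg {Θ : List Kind} (n : ℕ) (c : Cmd K) (N : Form Θ .neg) (Γ : Ctx Θ)
      (hn : ⟨.pos, n⟩ ∉ Γ.dom) :
      Rule .muNeg ![.cmd Θ c (Γ.cons ⟨.pos, n⟩ N)]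
        (.tm Θ .neg (.muNeg (c.close ⟨.pos, n⟩)) N Γ)
  | cut {Θ : List Kind} {p : Pol} (t : Tm K p) (u : Tm K p.dual) (A : Form Θ p)
      (Γ Γ' : Ctx Θ) (hd : Disjoint Γ.dom Γ'.dom) :
      Rule .cut ![.tm Θ p t A Γ, .tm Θ p.dual u A.neg Γ'] (.cmd Θ (com t u) (Γ.union Γ'))
  | tensor {Θ : List Kind} {p q : Pol} (V : Val K p) (V' : Val K q)
      (A : Form Θ p) (B : Form Θ q) (Γ Γ' : Ctx Θ) (hd : Disjoint Γ.dom Γ'.dom) :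
      Rule .tensor ![.tm Θ p V.toTm A Γ, .tm Θ q V'.toTm B Γ']
        (.tm Θ .pos (.ret (.pair V V')) (.tensor A B) (Γ.union Γ'))
  | par {Θ : List Kind} (κ κ' : TVar) (c : Cmd K) (A : Form Θ κ.pol.dual)
      (B : Form Θ κ'.pol.dual) (Γ : Ctx Θ) (hne : κ ≠ κ') (hκ : κ ∉ Γ.dom) (hκ' : κ' ∉ Γ.dom) :
      Rule .par ![.cmd Θ c ((Γ.cons κ' B).cons κ A)]
        (.tm Θ .neg (.muPair (c.close₂ κ κ')) (.par A B) Γ)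
  | down {Θ : List Kind} {p : Pol} (V : Val K p) (A : Form Θ p) (Γ : Ctx Θ) :
      Rule .down ![.tm Θ p V.toTm A Γ] (.tm Θ .pos (.ret (.box V)) (.down A) Γ)
  | up {Θ : List Kind} (κ : TVar) (c : Cmd K) (A : Form Θ κ.pol.dual) (Γ : Ctx Θ)
      (hκ : κ ∉ Γ.dom) :
      Rule .up ![.cmd Θ c (Γ.cons κ A)] (.tm Θ .neg (.muBox (c.close κ)) (.up A) Γ)
  | ex {Θ : List Kind} {p : Pol} {τ : Kind} (T : Con Θ τ) (t : Tm K p) (A : Form (τ :: Θ) p)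
      (Γ : Ctx Θ) :
      Rule .ex ![.tm Θ p t (A.subst₀ T) Γ] (.tm Θ p t (.ex τ A) Γ)
  | all {Θ : List Kind} {p : Pol} {τ : Kind} (V : Val K p) (A : Form (τ :: Θ) p) (Γ : Ctx Θ) :
      Rule .all ![.tm (τ :: Θ) p V.toTm A Γ.wk] (.tm Θ p V.toTm (.all τ A) Γ)
  | conv {Θ : List Kind} (κ : TVar) (c : Cmd K) (A B : Form Θ κ.pol.dual) (Γ : Ctx Θ)
      (hκ : κ ∉ Γ.dom) (hAB : Conv A B) :
      Rule .conv ![.cmd Θ c (Γ.cons κ A)] (.cmd Θ c (Γ.cons κ B))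
  | weak {Θ : List Kind} (κ : TVar) (c : Cmd K) (A : Form Θ κ.pol.dual) (Γ : Ctx Θ)
      (hκ : κ ∉ Γ.dom) :
      Rule .weak ![.cmd Θ c Γ] (.cmd Θ c (Γ.cons κ A))

/-- Typing derivations. -/
inductive Deriv {K : Pol → Type u} : Judgment K → Type u
  | step (R : RuleName) (J : Fin R.arity → Judgment K) (L : Judgment K) (h : Rule R J L)
      (π : ∀ i, Deriv (J i)) : Deriv L

/-! ## Quantitative monoids and poles -/

/-- Quantitative monoids: preordered commutative monoids of non-negative elements, with a
monotone and super-additive measure in the natural numbers. -/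
class QuantMonoid (M : Type v) extends AddCommMonoid M, Preorder M where
  add_le_add' : ∀ a b c d : M, a ≤ b → c ≤ d → a + c ≤ b + d
  zero_le' : ∀ a : M, 0 ≤ a
  measure : M → ℕ
  measure_add : ∀ a b : M, measure a + measure b ≤ measure (a + b)
  measure_mono : ∀ a b : M, a ≤ b → measure a ≤ measure b

/-- Quantitative poles: sets of weighted closed commands. -/
structure QuantPole (K : Pol → Type u) (M : Type v) [QuantMonoid M] where
  carrier : Set (Cmd K × M)
  closed : ∀ w ∈ carrier, w.1.Closed

/-- Saturated quantitative poles. -/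
structure SaturatedPole (K : Pol → Type u) (M : Type v) [QuantMonoid M] extends
    QuantPole K M where
  pβ : M
  beta_sat : ∀ (c c' : Cmd K) (p : M), c.Closed → RedBeta c c' →
    (c', p) ∈ carrier → (c, p + pβ) ∈ carrier
  mu_sat : ∀ (c c' : Cmd K) (p : M), c.Closed → RedMu c c' →
    ((c', p) ∈ carrier ↔ (c, p) ∈ carrier)
  le_sat : ∀ (c : Cmd K) (p p' : M), p ≤ p' → (c, p) ∈ carrier → (c, p') ∈ carrier

section Orthogonality

variable {K : Pol → Type u} {M : Type v} [QuantMonoid M]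

/-- The orthogonal of a set of weighted closed terms of polarity `p`. -/
def QuantPole.orth (S : QuantPole K M) {p : Pol} (X : Set (Tm K p × M)) :
    Set (Tm K p.dual × M) :=
  {w | w.1.Closed ∧ ∀ v ∈ X, (com v.1 w.1, v.2 + w.2) ∈ S.carrier}

/-- A set of weighted values, as a set of weighted terms. -/
def valSet {p : Pol} (X : Set (Val K p × M)) : Set (Tm K p × M) :=
  (fun w => (w.1.toTm, w.2)) '' X

/-- The biorthogonal of a set of weighted closed values. -/
def QuantPole.biorth (S : QuantPole K M) : {p : Pol} → Set (Val K p × M) → Set (Tm K p × M)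
  | .pos, X => S.orth (p := .neg) (S.orth (valSet X))
  | .neg, X => S.orth (p := .pos) (S.orth (valSet X))

/-- The closure of `X` under `≤`. -/
def leClosure {p : Pol} (X : Set (Val K p × M)) : Set (Val K p × M) :=
  {w | ∃ m : M, m ≤ w.2 ∧ (w.1, m) ∈ X}

/-- `X ⊗ Y` -/
def setTensor {p q : Pol} (X : Set (Val K p × M)) (Y : Set (Val K q × M)) :
    Set (Val K .pos × M) :=
  {w | ∃ v ∈ X, ∃ v' ∈ Y, w = (.pair v.1 v'.1, v.2 + v'.2)}

/-- `↓ X` -/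
def setDown {p : Pol} (X : Set (Val K p × M)) : Set (Val K .pos × M) :=
  {w | ∃ v ∈ X, w = (.box v.1, v.2)}

/-- For a set `D` of sets of weighted positive values: `D` itself (for `p = pos`), or the set
of the orthogonals of its elements (for `p = neg`). -/
def QuantPole.domain (S : QuantPole K M) (D : Set (Set (Val K .pos × M))) :
    (p : Pol) → Set (Set (Val K p × M))
  | .pos => D
  | .neg => {Y | ∃ X ∈ D, Y = S.orth (valSet X)}

end Orthogonality

/-- Positive propositional domains. -/
structure PosDomain {K : Pol → Type u} {M : Type v} [QuantMonoid M] (S : QuantPole K M) where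
  carrier : Set (Set (Val K .pos × M))
  closed : ∀ X ∈ carrier, ∀ w ∈ X, w.1.Closed
  nonempty : carrier.Nonempty
  sUnion_mem : ∀ F : Set (Set (Val K .pos × M)), F ⊆ carrier → F.Nonempty → ⋃₀ F ∈ carrier
  sInter_mem : ∀ F : Set (Set (Val K .pos × M)), F ⊆ carrier → F.Nonempty → ⋂₀ F ∈ carrier
  tensor_mem : ∀ (p q : Pol), ∀ X ∈ S.domain carrier p, ∀ Y ∈ S.domain carrier q,
    setTensor X Y ∈ carrier
  down_mem : ∀ (p : Pol), ∀ X ∈ S.domain carrier p, setDown X ∈ carrier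

/-! ## Interpretation of kinds and constructors -/

section Interpretation

variable {K : Pol → Type u} {M : Type v} [QuantMonoid M] {S : QuantPole K M}

/-- An element `X^⊥` of the negative domain, given together with the element `X` of the
positive domain of which it is the orthogonal. -/
structure NegElt (D : PosDomain S) : Type (max u v) where
  predual : Set (Val K .pos × M)
  mem : predual ∈ D.carrier

/-- The interpretation of kinds. -/
def Sem (D : PosDomain S) : Kind → Type (max u v)
  | .iota => ULift.{max u v} ℕ
  | .o .pos => {X : Set (Val K .pos × M) // X ∈ D.carrier}
  | .o .neg => NegElt D
  | .arr σ τ => Sem D σ → Sem D τ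

/-- The set of weighted values underlying an element of the interpretation of `o^p`. -/
def Sem.set {D : PosDomain S} : {p : Pol} → Sem D (.o p) → Set (Val K p × M)
  | .pos, X => X.1
  | .neg, Y => S.orth (valSet Y.predual)

/-- The orthogonality `⊥(·, κ)`, extended to all kinds; on negative formulas it maps `X^⊥`
to `X`. -/
def Sem.perp {D : PosDomain S} : {κ : Kind} → Sem D κ → Sem D κ.dual
  | .iota, n => n
  | .o .pos, X => NegElt.mk X.1 X.2
  | .o .neg, Y => ⟨Y.predual, Y.mem⟩
  | .arr _ _, f => fun v => Sem.perp (f v)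

theorem Sem.set_mem {D : PosDomain S} :
    {p : Pol} → (X : Sem D (.o p)) → X.set ∈ S.domain D.carrier p
  | .pos, X => X.2
  | .neg, Y => ⟨Y.predual, Y.mem, rfl⟩

theorem Sem.nonempty (D : PosDomain S) : (κ : Kind) → Nonempty (Sem D κ)
  | .iota => ⟨(ULift.up 0 : ULift ℕ)⟩
  | .o .pos => D.nonempty.elim fun X hX => ⟨⟨X, hX⟩⟩
  | .o .neg => D.nonempty.elim fun X hX => ⟨NegElt.mk X hX⟩
  | .arr _ τ => (Sem.nonempty D τ).elim fun v => ⟨fun _ => v⟩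

theorem PosDomain.iUnion_mem (D : PosDomain S) {σ : Kind}
    (F : Sem D σ → Set (Val K .pos × M)) (hF : ∀ v, F v ∈ D.carrier) :
    (⋃ v, F v) ∈ D.carrier := by
  have := Sem.nonempty D σ
  have := D.sUnion_mem (Set.range F) (Set.range_subset_iff.2 hF) (Set.range_nonempty F)
  simpa [Set.sUnion_range] using this

theorem PosDomain.iInter_mem (D : PosDomain S) {σ : Kind}
    (F : Sem D σ → Set (Val K .pos × M)) (hF : ∀ v, F v ∈ D.carrier) :
    (⋂ v, F v) ∈ D.carrier := by
  have := Sem.nonempty D σ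
  have := D.sInter_mem (Set.range F) (Set.range_subset_iff.2 hF) (Set.range_nonempty F)
  simpa [Set.sInter_range] using this

/-- `⋃_v F v` for positive formulas, `(⋂_v (F v)^⊥)^⊥` for negative formulas. -/
def Sem.ex {D : PosDomain S} {σ : Kind} :
    {p : Pol} → (Sem D σ → Sem D (.o p)) → Sem D (.o p)
  | .pos, F => ⟨⋃ v, (F v).1, D.iUnion_mem _ fun v => (F v).2⟩
  | .neg, F => NegElt.mk (⋂ v, (Sem.perp (κ := .o .neg) (F v)).1)
      (D.iInter_mem _ fun v => (Sem.perp (κ := .o .neg) (F v)).2)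

/-- `⋂_v F v` for positive formulas, `(⋃_v (F v)^⊥)^⊥` for negative formulas. -/
def Sem.all {D : PosDomain S} {σ : Kind} :
    {p : Pol} → (Sem D σ → Sem D (.o p)) → Sem D (.o p)
  | .pos, F => ⟨⋂ v, (F v).1, D.iInter_mem _ fun v => (F v).2⟩
  | .neg, F => NegElt.mk (⋃ v, (Sem.perp (κ := .o .neg) (F v)).1)
      (D.iUnion_mem _ fun v => (Sem.perp (κ := .o .neg) (F v)).2)

/-- `X ⊗ Y` -/
def Sem.tensor {D : PosDomain S} {p q : Pol} (X : Sem D (.o p)) (Y : Sem D (.o q)) :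
    Sem D (.o .pos) :=
  ⟨setTensor X.set Y.set, D.tensor_mem _ _ _ (Sem.set_mem _) _ (Sem.set_mem _)⟩

/-- `↓ X` -/
def Sem.down {D : PosDomain S} {p : Pol} (X : Sem D (.o p)) : Sem D (.o .pos) :=
  ⟨setDown X.set, D.down_mem _ _ (Sem.set_mem _)⟩

/-- `(X^⊥ ⊗ Y^⊥)^⊥` -/
def Sem.par {D : PosDomain S} {p q : Pol} (X : Sem D (.o p)) (Y : Sem D (.o q)) :
    Sem D (.o .neg) :=
  Sem.perp (κ := .o .pos) (Sem.tensor (p := p.dual) (q := q.dual) X.perp Y.perp)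

/-- `(↓ X^⊥)^⊥` -/
def Sem.up {D : PosDomain S} {p : Pol} (X : Sem D (.o p)) : Sem D (.o .neg) :=
  Sem.perp (κ := .o .pos) (Sem.down (p := p.dual) X.perp)

/-- Valuations of the constructor variables in `Θ`. -/
abbrev Valuation (D : PosDomain S) (Θ : List Kind) : Type (max u v) := ∀ τ, Ix Θ τ → Sem D τ

/-- `ρ[x ← v]`, for the new variable `x`. -/
def Valuation.cons {D : PosDomain S} {Θ : List Kind} {σ : Kind} (ρ : Valuation D Θ)
    (v : Sem D σ) : Valuation D (σ :: Θ)
  | _, .zero => v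
  | _, .succ x => ρ _ x

/-- The interpretation of constructors. The orthogonal of the interpretation of `A` is used in
place of the interpretation of `A^⊥`, with which it coincides by `interp_neg` below. -/
def Con.interp {D : PosDomain S} : {Θ : List Kind} → {κ : Kind} → Con Θ κ →
    Valuation D Θ → Sem D κ
  | _, _, .var x, ρ => ρ _ x
  | _, _, .nvar x, ρ => Sem.perp (ρ _ x)
  | _, _, .lam T, ρ => fun v => T.interp (ρ.cons v)
  | _, _, .app T U, ρ => (show Sem D _ → Sem D _ from T.interp ρ) (U.interp ρ)
  | _, _, .zero, _ => (ULift.up 0 : ULift ℕ)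
  | _, _, .succ, _ => fun n : ULift ℕ => (ULift.up (n.down + 1) : ULift ℕ)
  | _, _, .recN τ, _ => fun (a : Sem D τ) (f : ULift ℕ → Sem D τ → Sem D τ) (n : ULift ℕ) =>
      (Nat.rec a (fun m r => f (ULift.up m) r) n.down : Sem D τ)
  | _, _, .recD τ, _ => fun (a : Sem D τ) (f : ULift ℕ → Sem D τ → Sem D τ) (n : ULift ℕ) =>
      Sem.perp (Nat.rec a (fun m r => f (ULift.up m) r) n.down : Sem D τ)
  | _, _, .tensor A B, ρ => Sem.tensor (A.interp ρ) (B.interp ρ)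
  | _, _, .par A B, ρ => Sem.par (A.interp ρ) (B.interp ρ)
  | _, _, .ex _ A, ρ => Sem.ex fun v => A.interp (ρ.cons v)
  | _, _, .all _ A, ρ => Sem.all fun v => A.interp (ρ.cons v)
  | _, _, .down A, ρ => Sem.down (A.interp ρ)
  | _, _, .up A, ρ => Sem.up (A.interp ρ)

theorem Sem.perp_perp {D : PosDomain S} :
    {κ : Kind} → (v : Sem D κ) → Sem.perp (Sem.perp v) = κ.dual_dual.symm ▸ v
  | .iota, _ => rfl
  | .o .pos, _ => rfl
  | .o .neg, _ => rfl
  | .arr σ τ, f => by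
      have h : ∀ (κ : Kind) (e : τ = κ) (e' : Kind.arr σ τ = Kind.arr σ κ),
          (e' ▸ f : Sem D (.arr σ κ)) = fun v => (e ▸ f v : Sem D κ) := by
        intro κ e e'
        subst e
        rfl
      exact (funext fun v => Sem.perp_perp (f v)).trans (h _ τ.dual_dual.symm _).symm

theorem Con.interp_cast {D : PosDomain S} {Θ : List Kind} {κ κ' : Kind} (e : κ = κ')
    (T : Con Θ κ) (ρ : Valuation D Θ) : (e ▸ T).interp ρ = e ▸ T.interp ρ := by
  subst e
  rfl

theorem Sem.perp_ex {D : PosDomain S} {σ : Kind} : {p : Pol} → (F : Sem D σ → Sem D (.o p)) →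
    Sem.perp (Sem.ex F) = Sem.all (p := p.dual) fun v => Sem.perp (F v)
  | .pos, _ => rfl
  | .neg, _ => rfl

theorem Sem.perp_all {D : PosDomain S} {σ : Kind} : {p : Pol} → (F : Sem D σ → Sem D (.o p)) →
    Sem.perp (Sem.all F) = Sem.ex (p := p.dual) fun v => Sem.perp (F v)
  | .pos, _ => rfl
  | .neg, _ => rfl

theorem Sem.perp_tensor {D : PosDomain S} : {p q : Pol} → (X : Sem D (.o p)) →
    (Y : Sem D (.o q)) → Sem.par (p := p.dual) (q := q.dual) X.perp Y.perp =
      Sem.perp (κ := .o .pos) (Sem.tensor X Y)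
  | .pos, .pos, _, _ => rfl
  | .pos, .neg, _, _ => rfl
  | .neg, .pos, _, _ => rfl
  | .neg, .neg, _, _ => rfl

theorem Sem.perp_down {D : PosDomain S} : {p : Pol} → (X : Sem D (.o p)) →
    Sem.up (p := p.dual) X.perp = Sem.perp (κ := .o .pos) (Sem.down X)
  | .pos, _ => rfl
  | .neg, _ => rfl

/-- `⟦T^⊥⟧_ρ = ⊥(⟦T⟧_ρ)` -/
theorem Con.interp_neg {D : PosDomain S} {Θ : List Kind} {κ : Kind} (T : Con Θ κ)
    (ρ : Valuation D Θ) : T.neg.interp ρ = Sem.perp (T.interp ρ) := by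
  induction T with
  | var x => rfl
  | nvar x => exact (Con.interp_cast _ _ ρ).trans (Sem.perp_perp _).symm
  | lam T ih => exact funext fun v => ih _
  | app T U ih _ => exact congrFun (ih ρ) _
  | zero => rfl
  | succ => rfl
  | recN τ => rfl
  | @recD Θ τ =>
    have h : ∀ (κ : Kind) (e : τ = κ),
        Con.interp (D := D) ((congrArg (fun κ => Con Θ (.arr τ (.arr (.arr .iota (.arr τ τ))
          (.arr .iota κ)))) e).mp (.recN τ)) ρ =
        fun (a : Sem D τ) (f : ULift ℕ → Sem D τ → Sem D τ) (n : ULift ℕ) =>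
          ((congrArg (Sem D) e).mp
            (Nat.rec a (fun m r => f (ULift.up m) r) n.down : Sem D τ) : Sem D κ) := by
      intro κ e
      subst e
      rfl
    refine (h _ τ.dual_dual.symm).trans ?_
    funext a f n
    refine Eq.trans ?_ (Sem.perp_perp _).symm
    have h' : ∀ (κ : Kind) (e : τ = κ) (x : Sem D τ), (congrArg (Sem D) e).mp x = e ▸ x := by
      intro κ e x
      subst e
      rfl
    exact h' _ _ _
  | tensor A B ihA ihB =>
    refine (congrArg₂ Sem.par (ihA ρ) (ihB ρ)).trans ?_
    exact Sem.perp_tensor _ _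
  | par A B ihA ihB =>
    exact congrArg₂ Sem.tensor (ihA ρ) (ihB ρ)
  | ex σ A ih =>
    refine Eq.trans ?_ (Sem.perp_ex _).symm
    exact congrArg Sem.all (funext fun v => ih _)
  | all σ A ih =>
    refine Eq.trans ?_ (Sem.perp_all _).symm
    exact congrArg Sem.ex (funext fun v => ih _)
  | down A ih =>
    refine (congrArg Sem.up (ih ρ)).trans ?_
    exact Sem.perp_down _
  | up A ih =>
    exact congrArg Sem.down (ih ρ)

/-- `⟦A⟧_ρ`, as a set of weighted values. -/
def Form.val {D : PosDomain S} {Θ : List Kind} {p : Pol} (A : Form Θ p) (ρ : Valuation D Θ) :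
    Set (Val K p × M) :=
  Sem.set (Con.interp A ρ)

end Interpretation

/-! ## Adequacy -/

section Adequacy

variable {K : Pol → Type u} {M : Type v} [QuantMonoid M] {S : QuantPole K M}

/-- Substitutions: finite partial functions from term variables to weighted values. -/
abbrev Subst (K : Pol → Type u) (M : Type v) : Type (max u v) := FMap fun x => Val K x.pol × M

/-- `e[V₁/κ₁, …, Vₙ/κₙ]` -/
def Exp.substVars {c : Cat} (e : Exp K [] c) (σ : Subst K M) : Exp K [] c :=
  e.bind noB (fun x => ((σ.toFun x).map Prod.fst).getD (fv x))

/-- The sum `p₁ + … + pₙ` of the weights of a substitution. -/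
noncomputable def Subst.weight (σ : Subst K M) : M :=
  ∑ x ∈ σ.dom, ((σ.toFun x).map Prod.snd).getD 0

/-- `σ ⊩ Γ[ρ]` -/
def Subst.AdequateFor {D : PosDomain S} {Θ : List Kind} (σ : Subst K M) (Γ : Ctx Θ)
    (ρ : Valuation D Θ) : Prop :=
  σ.dom = Γ.dom ∧ ∀ (x : TVar) (A : Form Θ x.pol.dual) (w : Val K x.pol × M),
    Γ.toFun x = some A → σ.toFun x = some w →
      w ∈ (show Form Θ x.pol from x.pol.dual_dual ▸ A.neg).val ρ

/-- `p`-adequate judgments. -/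
def Judgment.Adequate (D : PosDomain S) (m : M) : Judgment K → Prop
  | .cmd Θ c Γ => ∀ (ρ : Valuation D Θ) (σ : Subst K M), σ.AdequateFor Γ ρ →
      (c.substVars σ, m + σ.weight) ∈ S.carrier
  | .tm Θ _ t B Γ => ∀ (ρ : Valuation D Θ) (σ : Subst K M), σ.AdequateFor Γ ρ →
      (t.substVars σ, m + σ.weight) ∈ S.biorth (B.val ρ) ∧
      ∀ V : Val K _, t = V.toTm → (V.substVars σ, m + σ.weight) ∈ leClosure (B.val ρ)

/-- Strictly `p`-adequate judgments: values have to be in `⟦B⟧_ρ` itself, not only in its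
closure under `≤`. -/
def Judgment.StrictlyAdequate (D : PosDomain S) (m : M) : Judgment K → Prop
  | .cmd Θ c Γ => ∀ (ρ : Valuation D Θ) (σ : Subst K M), σ.AdequateFor Γ ρ →
      (c.substVars σ, m + σ.weight) ∈ S.carrier
  | .tm Θ _ t B Γ => ∀ (ρ : Valuation D Θ) (σ : Subst K M), σ.AdequateFor Γ ρ →
      (t.substVars σ, m + σ.weight) ∈ S.biorth (B.val ρ) ∧
      ∀ V : Val K _, t = V.toTm → (V.substVars σ, m + σ.weight) ∈ B.val ρ

/-- Judgments on a positive formula. -/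
def Judgment.OnPositive : Judgment K → Prop
  | .cmd _ _ _ => False
  | .tm _ p _ _ _ => p = .pos

/-- All the elements of the positive domain are closed under `≤`. -/
def PosDomain.LeClosed (D : PosDomain S) : Prop := ∀ X ∈ D.carrier, leClosure X ⊆ X

/-- The function associated with each rule. -/
def cost (pβ : M) : (R : RuleName) → (Fin R.arity → M) → M
  | .axPos, _ => 0
  | .axNeg, _ => 0
  | .muPos, x => x (0 : Fin 1)
  | .muNeg, x => x (0 : Fin 1)
  | .cut, x => x (0 : Fin 2) + x (1 : Fin 2)
  | .tensor, x => x (0 : Fin 2) + x (1 : Fin 2)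
  | .par, x => x (0 : Fin 1) + pβ
  | .down, x => x (0 : Fin 1)
  | .up, x => x (0 : Fin 1) + pβ
  | .ex, x => x (0 : Fin 1)
  | .all, x => x (0 : Fin 1)
  | .conv, x => x (0 : Fin 1)
  | .weak, x => x (0 : Fin 1)

/-- The element of the monoid obtained by composing the functions of the rules of a
derivation. -/
def Deriv.cost (pβ : M) : {J : Judgment K} → Deriv J → M
  | _, .step R _ _ _ π => MALomega.cost pβ R fun i => (π i).cost pβ

end Adequacy

end MALomega

namespace MALomega

/-! ## Substitution in expressions -/

section Expressions

variable {K : Pol → Type u}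

/-! This is a realizability argument by biorthogonality, carried out rule by rule. A rule that
introduces a `μ` is tested against an arbitrary element of the relevant orthogonal. The resulting
cut reduces in one step to the command of the premise, under the given substitution extended by the
values just received (`Exp.inst_close`, `Exp.inst₂_close₂`). Adequacy of the premise puts this
reduct in the pole, and saturation brings the cut back in: at no cost for a `μ` step, at cost `pβ`
for a `β` step. This is why exactly `par` and `up` add `pβ`. The cut rule pairs an element of a
biorthogonal with one of the biorthogonal of the dual type (`com_mem_of_mem_biorth`).

The type-level rules rest on the soundness of the interpretation of constructors. Negation is
orthogonality, substitution is a change of valuation (`Con.interp_subst₀`), and convertible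
constructors have equal interpretations (`Conv.interp_eq`). Weights are sums over the domain of the
substitution. They therefore split over disjoint contexts, and scoping guarantees that restricting a
substitution to one of the contexts does not change its effect on the corresponding term.

Adequacy and strict adequacy differ only in whether values are located in `X` or in its closure
under `≤`, so both are treated at once through a proposition `strict` (`closureIf`). They diverge at
a single point, `∀` on a positive formula. Membership in all the closures does not give membership
in the closure of the intersection, because the lower weight may depend on the instance. Strictness,
or closure of the domain under `≤`, removes the obstacle. Negative interpretations are orthogonals
and hence closed under `≤` in any case. Derivations are therefore handled by induction on the strict
notion, which is weakened only at the end. -/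

theorem Exp.FV_ren {Δ Δ' : List Pol} {a : Cat} (e : Exp K Δ a) (r : ∀ p, Ix Δ p → Ix Δ' p) :
    (e.ren r).FV = e.FV := by
  induction e generalizing Δ' <;> simp only [Exp.ren, Exp.FV, *]

theorem Exp.FV_wk {Δ : List Pol} {q : Pol} {a : Cat} (e : Exp K Δ a) :
    (e.wk (q := q)).FV = e.FV :=
  e.FV_ren _

theorem FV_liftB_subset {Δ Δ' : List Pol} {q : Pol} {b : ∀ p, Ix Δ p → Exp K Δ' (.val p)}
    {s : Set TVar} (hb : ∀ p i, (b p i).FV ⊆ s) (p : Pol) (i : Ix (q :: Δ) p) :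
    (liftB b p i).FV ⊆ s := by
  cases i with
  | zero => exact Set.empty_subset _
  | succ i => exact (Exp.FV_wk _).trans_subset (hb _ i)

theorem FV_liftF {Δ' : List Pol} {q : Pol} (f : ∀ x : TVar, Exp K Δ' (.val x.pol)) (x : TVar) :
    (liftF (q := q) f x).FV = (f x).FV :=
  Exp.FV_wk _

/-- Bounding by a fixed set `s` lets the induction pass under binders, since lifting an assignment
introduces no new free name. -/
theorem Exp.FV_bind_subset {Δ Δ' : List Pol} {a : Cat} (e : Exp K Δ a)
    {b : ∀ p, Ix Δ p → Exp K Δ' (.val p)} {f : ∀ x : TVar, Exp K Δ' (.val x.pol)}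
    {s : Set TVar} (hb : ∀ p i, (b p i).FV ⊆ s) (hf : ∀ x ∈ e.FV, (f x).FV ⊆ s) :
    (e.bind b f).FV ⊆ s := by
  induction e generalizing Δ' with
  | bvar i => exact hb _ i
  | fvar n => exact hf _ rfl
  | instr k => exact Set.empty_subset _
  | pair V V' ih ih' | cut V V' ih ih' =>
    exact Set.union_subset (ih hb fun x hx => hf x (Or.inl hx))
      (ih' hb fun x hx => hf x (Or.inr hx))
  | box V ih | ret V ih => exact ih hb hf
  | muPair c ih =>
    exact ih (FV_liftB_subset (FV_liftB_subset hb))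
      fun x hx => by simpa only [FV_liftF] using hf x hx
  | muBox c ih | muNeg c ih | muPos c ih =>
    exact ih (FV_liftB_subset hb) fun x hx => by simpa only [FV_liftF] using hf x hx

theorem Exp.bind_congr {Δ Δ' : List Pol} {a : Cat} (e : Exp K Δ a)
    {b b' : ∀ p, Ix Δ p → Exp K Δ' (.val p)} {f f' : ∀ x : TVar, Exp K Δ' (.val x.pol)}
    (hb : b = b') (hf : ∀ x ∈ e.FV, f x = f' x) : e.bind b f = e.bind b' f' := by
  subst hb
  induction e generalizing Δ' with
  | bvar i => rfl
  | fvar n => exact hf _ rfl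
  | instr k => rfl
  | pair V V' ih ih' =>
    exact congrArg₂ Exp.pair (ih fun x hx => hf x (Or.inl hx)) (ih' fun x hx => hf x (Or.inr hx))
  | cut t u ih ih' =>
    exact congrArg₂ Exp.cut (ih fun x hx => hf x (Or.inl hx)) (ih' fun x hx => hf x (Or.inr hx))
  | box V ih => exact congrArg Exp.box (ih hf)
  | ret V ih => exact congrArg Exp.ret (ih hf)
  | muPair c ih =>
    exact congrArg Exp.muPair (ih fun x hx => congrArg (fun e => Exp.wk (Exp.wk e)) (hf x hx))
  | muBox c ih => exact congrArg Exp.muBox (ih fun x hx => congrArg Exp.wk (hf x hx))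
  | muNeg c ih => exact congrArg Exp.muNeg (ih fun x hx => congrArg Exp.wk (hf x hx))
  | muPos c ih => exact congrArg Exp.muPos (ih fun x hx => congrArg Exp.wk (hf x hx))

/-! ### Fusion laws for renaming and substitution -/

theorem liftRen_comp {α : Type} {l l' l'' : List α} {b : α} (r : ∀ a, Ix l a → Ix l' a)
    (r' : ∀ a, Ix l' a → Ix l'' a) :
    (fun a i => liftRen (b := b) r' a (liftRen r a i)) = liftRen fun a i => r' a (r a i) := by
  funext a i
  cases i <;> rfl

/-- First of four fusion laws, with `Exp.bind_ren`, `Exp.ren_bind` and `Exp.bind_bind`. Each is an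
induction whose binder case needs lifting to commute with composition. For the last two this is a
commutation with weakening, which the earlier laws supply. -/
theorem Exp.ren_ren {Δ Δ' Δ'' : List Pol} {a : Cat} (e : Exp K Δ a)
    (r : ∀ p, Ix Δ p → Ix Δ' p) (r' : ∀ p, Ix Δ' p → Ix Δ'' p) :
    (e.ren r).ren r' = e.ren fun p i => r' p (r p i) := by
  induction e generalizing Δ' Δ'' <;> simp only [Exp.ren, liftRen_comp, *]

theorem Exp.wk_ren {Δ Δ' : List Pol} {q : Pol} {a : Cat} (e : Exp K Δ a)
    (r : ∀ p, Ix Δ p → Ix Δ' p) : (e.wk (q := q)).ren (liftRen r) = (e.ren r).wk := by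
  simp only [Exp.wk, Exp.ren_ren]
  rfl

theorem liftB_liftRen {Δ Δ' Δ'' : List Pol} {q : Pol} (r : ∀ p, Ix Δ p → Ix Δ' p)
    (b : ∀ p, Ix Δ' p → Exp K Δ'' (.val p)) :
    (fun p i => liftB (q := q) b p (liftRen r p i)) = liftB fun p i => b p (r p i) := by
  funext p i
  cases i <;> rfl

theorem Exp.bind_ren {Δ Δ' Δ'' : List Pol} {a : Cat} (e : Exp K Δ a)
    (r : ∀ p, Ix Δ p → Ix Δ' p) (b : ∀ p, Ix Δ' p → Exp K Δ'' (.val p))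
    (f : ∀ x : TVar, Exp K Δ'' (.val x.pol)) :
    (e.ren r).bind b f = e.bind (fun p i => b p (r p i)) f := by
  induction e generalizing Δ' Δ'' <;> simp only [Exp.ren, Exp.bind, liftB_liftRen, *]

theorem liftB_ren {Δ Δ' Δ'' : List Pol} {q : Pol} (b : ∀ p, Ix Δ p → Exp K Δ' (.val p))
    (r : ∀ p, Ix Δ' p → Ix Δ'' p) :
    (fun p i => (liftB (q := q) b p i).ren (liftRen r)) = liftB fun p i => (b p i).ren r := by
  funext p i
  cases i with
  | zero => rfl
  | succ i => exact Exp.wk_ren _ _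

theorem liftF_ren {Δ' Δ'' : List Pol} {q : Pol} (f : ∀ x : TVar, Exp K Δ' (.val x.pol))
    (r : ∀ p, Ix Δ' p → Ix Δ'' p) :
    (fun x => (liftF (q := q) f x).ren (liftRen r)) = liftF fun x => (f x).ren r :=
  funext fun _ => Exp.wk_ren _ _

theorem Exp.ren_bind {Δ Δ' Δ'' : List Pol} {a : Cat} (e : Exp K Δ a)
    (b : ∀ p, Ix Δ p → Exp K Δ' (.val p)) (f : ∀ x : TVar, Exp K Δ' (.val x.pol))
    (r : ∀ p, Ix Δ' p → Ix Δ'' p) :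
    (e.bind b f).ren r = e.bind (fun p i => (b p i).ren r) (fun x => (f x).ren r) := by
  induction e generalizing Δ' Δ'' <;> simp only [Exp.ren, Exp.bind, liftB_ren, liftF_ren, *]

theorem Exp.wk_bind {Δ Δ' : List Pol} {q : Pol} {a : Cat} (e : Exp K Δ a)
    (b : ∀ p, Ix Δ p → Exp K Δ' (.val p)) (f : ∀ x : TVar, Exp K Δ' (.val x.pol)) :
    (e.wk (q := q)).bind (liftB b) (liftF f) = (e.bind b f).wk :=
  (Exp.bind_ren _ _ _ _).trans (Exp.ren_bind _ _ _ _).symm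

theorem liftB_bind {Δ Δ' Δ'' : List Pol} {q : Pol} (b : ∀ p, Ix Δ p → Exp K Δ' (.val p))
    (b' : ∀ p, Ix Δ' p → Exp K Δ'' (.val p)) (f' : ∀ x : TVar, Exp K Δ'' (.val x.pol)) :
    (fun p i => (liftB (q := q) b p i).bind (liftB b') (liftF f')) =
      liftB fun p i => (b p i).bind b' f' := by
  funext p i
  cases i with
  | zero => rfl
  | succ i => exact Exp.wk_bind _ _ _

theorem liftF_bind {Δ' Δ'' : List Pol} {q : Pol} (f : ∀ x : TVar, Exp K Δ' (.val x.pol))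
    (b' : ∀ p, Ix Δ' p → Exp K Δ'' (.val p)) (f' : ∀ x : TVar, Exp K Δ'' (.val x.pol)) :
    (fun x => (liftF (q := q) f x).bind (liftB b') (liftF f')) =
      liftF fun x => (f x).bind b' f' :=
  funext fun _ => Exp.wk_bind _ _ _

theorem Exp.bind_bind {Δ Δ' Δ'' : List Pol} {a : Cat} (e : Exp K Δ a)
    (b : ∀ p, Ix Δ p → Exp K Δ' (.val p)) (f : ∀ x : TVar, Exp K Δ' (.val x.pol))
    (b' : ∀ p, Ix Δ' p → Exp K Δ'' (.val p)) (f' : ∀ x : TVar, Exp K Δ'' (.val x.pol)) :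
    (e.bind b f).bind b' f' =
      e.bind (fun p i => (b p i).bind b' f') (fun x => (f x).bind b' f') := by
  induction e generalizing Δ' Δ'' <;> simp only [Exp.bind, liftB_bind, liftF_bind, *]

theorem liftB_bvar {Δ : List Pol} {q : Pol} :
    (liftB fun _ i => .bvar i : ∀ p, Ix (q :: Δ) p → Exp K (q :: Δ) (.val p)) =
      fun _ i => .bvar i := by
  funext _ i
  cases i <;> rfl

theorem liftF_fv {Δ : List Pol} {q : Pol} :
    (liftF fv : ∀ x : TVar, Exp K (q :: Δ) (.val x.pol)) = fv :=
  rfl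

theorem Exp.bind_id {Δ : List Pol} {a : Cat} (e : Exp K Δ a) :
    e.bind (fun _ i => .bvar i) fv = e := by
  induction e <;> simp only [Exp.bind, liftB_bvar, liftF_fv, *]
  rfl

theorem noB_eq {Δ : List Pol} (b b' : ∀ q, Ix [] q → Exp K Δ (.val q)) : b = b' :=
  funext fun _ => funext fun i => nomatch i

theorem Exp.bind_fv (e : Exp K [] a) (b : ∀ q, Ix [] q → Exp K [] (.val q)) : e.bind b fv = e :=
  (e.bind_congr (noB_eq _ _) fun _ _ => rfl).trans e.bind_id

/-- Substituting for the bound variable after closing amounts to substituting for the name. -/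
theorem Exp.inst_close (κ : TVar) {a : Cat} (e : Exp K [] a)
    (f : ∀ x : TVar, Exp K [] (.val x.pol)) (V : Val K κ.pol) :
    ((e.close κ).bind (liftB noB) (liftF f)).inst V =
      e.bind noB (Function.update f κ V) := by
  simp only [Exp.close, Exp.inst, Exp.bind_bind]
  refine e.bind_congr (noB_eq _ _) fun x _ => ?_
  by_cases h : x = κ
  · subst h
    simp [Exp.bind, liftB, oneB]
  · simp only [h, dite_false, Function.update_of_ne h]
    -- The value `f x` was weakened to pass under the binder; instantiation undoes the weakening.
    exact (Exp.bind_ren _ _ _ _).trans (Exp.bind_fv _ _)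

/-- Two-variable analogue of `Exp.inst_close`. The update at `κ` is outermost because `Exp.close₂`
tests for `κ` first. -/
theorem Exp.inst₂_close₂ {κ κ' : TVar} (hne : κ ≠ κ') {a : Cat} (e : Exp K [] a)
    (f : ∀ x : TVar, Exp K [] (.val x.pol)) (V : Val K κ.pol) (V' : Val K κ'.pol) :
    ((e.close₂ κ κ').bind (liftB (liftB noB)) (liftF (liftF f))).inst₂ V V' =
      e.bind noB (Function.update (Function.update f κ' V') κ V) := by
  simp only [Exp.close₂, Exp.inst₂, Exp.bind_bind]
  refine e.bind_congr (noB_eq _ _) fun x _ => ?_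
  by_cases h : x = κ
  · subst h
    simp [Exp.bind, liftB, twoB]
  · by_cases h' : x = κ'
    · subst h'
      simp [h, Exp.bind, liftB, twoB, Exp.wk, Exp.ren]
    · simp only [h, h', dite_false, Function.update_of_ne h, Function.update_of_ne h']
      exact (Exp.bind_ren _ _ _ _).trans ((Exp.bind_ren _ _ _ _).trans (Exp.bind_fv _ _))

/-! ### Free variables of abstractions, values and cuts -/

theorem FV_fv {Δ : List Pol} (x : TVar) : (fv x : Exp K Δ _).FV = {x} := rfl

theorem Exp.FV_close_subset (κ : TVar) {a : Cat} (e : Exp K [] a) {s : Set TVar}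
    (h : e.FV ⊆ insert κ s) : (e.close κ).FV ⊆ s := by
  refine e.FV_bind_subset (fun _ i => nomatch i) fun x hx => ?_
  by_cases hκ : x = κ
  · subst hκ
    simp [Exp.FV]
  · simpa [hκ, FV_fv] using (h hx).resolve_left hκ

theorem Exp.FV_close₂_subset (κ κ' : TVar) {a : Cat} (e : Exp K [] a) {s : Set TVar}
    (h : e.FV ⊆ insert κ (insert κ' s)) : (e.close₂ κ κ').FV ⊆ s := by
  refine e.FV_bind_subset (fun _ i => nomatch i) fun x hx => ?_
  by_cases hκ : x = κ
  · subst hκ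
    simp [Exp.FV]
  · by_cases hκ' : x = κ'
    · subst hκ'
      simp [hκ, Exp.FV]
    · simpa [hκ, hκ', FV_fv] using ((h hx).resolve_left hκ).resolve_left hκ'

theorem Val.toTm_injective {p : Pol} : Function.Injective (Val.toTm : Val K p → Tm K p) := by
  intro V V' h
  cases p with
  | pos => exact Exp.ret.inj h
  | neg => exact h

theorem Val.FV_toTm {p : Pol} (V : Val K p) : V.toTm.FV = V.FV := by
  cases p <;> rfl

theorem FV_com {p : Pol} (t : Tm K p) (u : Tm K p.dual) : (com t u).FV = t.FV ∪ u.FV := by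
  cases p
  · rfl
  · exact Set.union_comm _ _

end Expressions

/-! ## Interpretation of renamings, substitutions and conversions -/

section Semantics

variable {K : Pol → Type u} {M : Type v} [QuantMonoid M] {S : QuantPole K M} {D : PosDomain S}

theorem Valuation.cons_liftRen {Θ Θ' : List Kind} {σ : Kind} (r : ∀ τ, Ix Θ τ → Ix Θ' τ)
    (ρ : Valuation D Θ') (v : Sem D σ) :
    (fun τ x => ρ.cons v τ (liftRen r τ x)) =
      Valuation.cons (fun τ x => ρ τ (r τ x) : Valuation D Θ) v := by
  funext τ x
  cases x <;> rfl

theorem Con.interp_ren {Θ Θ' : List Kind} {κ : Kind} (T : Con Θ κ)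
    (r : ∀ τ, Ix Θ τ → Ix Θ' τ) (ρ : Valuation D Θ') :
    (T.ren r).interp ρ = T.interp fun τ x => ρ τ (r τ x) := by
  induction T generalizing Θ' with
  | var | nvar | zero | succ | recN | recD => rfl
  | lam T ih =>
    exact funext fun v => (ih _ _).trans (congrArg T.interp (Valuation.cons_liftRen _ _ _))
  | app T U ih ih' => simp only [Con.ren, Con.interp, ih, ih']
  | tensor A B ih ih' | par A B ih ih' => simp only [Con.ren, Con.interp, ih, ih']
  | ex σ A ih | all σ A ih => simp only [Con.ren, Con.interp, ih, Valuation.cons_liftRen]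
  | down A ih | up A ih => simp only [Con.ren, Con.interp, ih]

theorem Con.interp_wk {Θ : List Kind} {σ κ : Kind} (T : Con Θ κ) (ρ : Valuation D Θ)
    (v : Sem D σ) : T.wk.interp (ρ.cons v) = T.interp ρ :=
  T.interp_ren _ _

theorem Valuation.cons_liftS {Θ Θ' : List Kind} {σ : Kind} (s : ∀ τ, Ix Θ τ → Con Θ' τ)
    (ρ : Valuation D Θ') (v : Sem D σ) :
    (fun τ x => (liftS s τ x).interp (ρ.cons v)) =
      Valuation.cons (fun τ x => (s τ x).interp ρ : Valuation D Θ) v := by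
  funext τ x
  cases x with
  | zero => rfl
  | succ x => exact Con.interp_wk _ _ _

theorem Con.interp_subst {Θ Θ' : List Kind} {κ : Kind} (T : Con Θ κ)
    (s : ∀ τ, Ix Θ τ → Con Θ' τ) (ρ : Valuation D Θ') :
    (T.subst s).interp ρ = T.interp fun τ x => (s τ x).interp ρ := by
  induction T generalizing Θ' with
  -- Dual atoms are where the syntactic negation of the substituted constructor has to mean
  -- orthogonality.
  | nvar x => exact Con.interp_neg _ _
  | var | zero | succ | recN | recD => rfl
  | lam T ih =>
    exact funext fun v => (ih _ _).trans (congrArg T.interp (Valuation.cons_liftS _ _ _))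
  | app T U ih ih' => simp only [Con.subst, Con.interp, ih, ih']
  | tensor A B ih ih' | par A B ih ih' => simp only [Con.subst, Con.interp, ih, ih']
  | ex σ A ih | all σ A ih => simp only [Con.subst, Con.interp, ih, Valuation.cons_liftS]
  | down A ih | up A ih => simp only [Con.subst, Con.interp, ih]

theorem Con.interp_subst₀ {Θ : List Kind} {σ κ : Kind} (T : Con (σ :: Θ) κ) (U : Con Θ σ)
    (ρ : Valuation D Θ) : (T.subst₀ U).interp ρ = T.interp (ρ.cons (U.interp ρ)) := by
  refine (T.interp_subst _ _).trans (congrArg T.interp ?_)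
  funext τ x
  cases x <;> rfl

/-- Arrow kinds are full function spaces, so `β` is the substitution lemma and `η` is
extensionality. The recursor equations hold by computation, and those of the dual recursor follow
from `Con.interp_neg`, orthogonality being pointwise on functions. -/
theorem Conv.interp_eq {Θ : List Kind} {κ : Kind} {T T' : Con Θ κ} (h : Conv T T')
    (ρ : Valuation D Θ) : T.interp ρ = T'.interp ρ := by
  induction h with
  | beta T U => exact (T.interp_subst₀ U ρ).symm
  | eta T => exact funext fun v => congrFun (T.interp_wk ρ v) v
  | recN_zero | recN_succ => rfl
  | recD_zero T U => exact (T.interp_neg ρ).symm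
  | recD_succ T U n => exact (congrFun (congrFun (U.interp_neg ρ) _) _).symm
  | refl => rfl
  | symm _ ih => exact (ih ρ).symm
  | trans _ _ ih ih' => exact (ih ρ).trans (ih' ρ)
  | lam _ ih => exact funext fun v => ih _
  | app _ _ ih ih' => simp only [Con.interp, ih, ih']
  | tensor _ _ ih ih' => exact congrArg₂ Sem.tensor (ih ρ) (ih' ρ)
  | par _ _ ih ih' => exact congrArg₂ Sem.par (ih ρ) (ih' ρ)
  | ex _ ih => exact congrArg Sem.ex (funext fun v => ih _)
  | all _ ih => exact congrArg Sem.all (funext fun v => ih _)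
  | down _ ih => exact congrArg Sem.down (ih ρ)
  | up _ ih => exact congrArg Sem.up (ih ρ)

end Semantics

/-! ## Finite maps -/

namespace FMap

variable {β : TVar → Type v}

theorem mem_dom {f : FMap β} {x : TVar} : x ∈ f.dom ↔ (f.toFun x).isSome :=
  f.finite.mem_toFinset

theorem dom_empty : (empty : FMap β).dom = ∅ := by
  ext x
  simp [mem_dom, empty]

theorem dom_cons (f : FMap β) (κ : TVar) (a : β κ) : (f.cons κ a).dom = insert κ f.dom := by
  ext x
  by_cases h : x = κ
  · subst h
    simp [mem_dom, cons]
  · simp [mem_dom, cons, h]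

theorem dom_union (f g : FMap β) : (f.union g).dom = f.dom ∪ g.dom := by
  ext x
  simp [mem_dom, union, Option.isSome_or]

theorem dom_map {γ : TVar → Type v} (h : ∀ x, β x → γ x) (f : FMap β) :
    (f.map h).dom = f.dom := by
  ext x
  simp [mem_dom, map]

/-- The restriction to a finite set of variables. -/
def restrict (f : FMap β) (s : Finset TVar) : FMap β where
  toFun x := if x ∈ s then f.toFun x else none
  finite := f.finite.subset fun x hx => by
    by_cases h : x ∈ s <;> simp_all

theorem restrict_of_mem (f : FMap β) {s : Finset TVar} {x : TVar} (h : x ∈ s) :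
    (f.restrict s).toFun x = f.toFun x :=
  if_pos h

theorem dom_restrict (f : FMap β) {s : Finset TVar} (hs : s ⊆ f.dom) :
    (f.restrict s).dom = s := by
  ext x
  by_cases h : x ∈ s
  · simpa [mem_dom, restrict, h] using mem_dom.1 (hs h)
  · simp [mem_dom, restrict, h]

/-- A map whose domain is `insert κ s` is obtained by adding a value at `κ` to its restriction
to `s`. -/
theorem exists_eq_cons_restrict {f : FMap β} {κ : TVar} {s : Finset TVar}
    (hf : f.dom = insert κ s) : ∃ a, f.toFun κ = some a ∧ f = (f.restrict s).cons κ a := by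
  obtain ⟨a, ha⟩ := Option.isSome_iff_exists.1 (mem_dom.1 (hf ▸ Finset.mem_insert_self κ s))
  refine ⟨a, ha, FMap.ext (funext fun x => ?_)⟩
  by_cases h : x = κ
  · subst h
    simp [cons, ha]
  · by_cases hs : x ∈ s
    · simp [cons, h, restrict, hs]
    · have : x ∉ f.dom := by simp [hf, h, hs]
      simpa [cons, h, restrict, hs, mem_dom] using this

end FMap

/-! ## Substitutions -/

section Substitutions

variable {K : Pol → Type u} {M : Type v}

/-- The value substituted for a variable. -/
def Subst.value (σ : Subst K M) (x : TVar) : Val K x.pol :=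
  ((σ.toFun x).map Prod.fst).getD (fv x)

/-- Puts an extended substitution in the form produced by `Exp.inst_close`. -/
theorem Subst.value_cons (σ : Subst K M) (κ : TVar) (w : Val K κ.pol × M) :
    Subst.value (FMap.cons σ κ w) = Function.update σ.value κ w.1 := by
  funext x
  by_cases h : x = κ
  · subst h
    simp [Subst.value, FMap.cons]
  · simp [Subst.value, FMap.cons, h]

theorem Exp.substVars_eq {a : Cat} (e : Exp K [] a) (σ : Subst K M) :
    e.substVars σ = e.bind noB σ.value :=
  rfl

theorem Exp.substVars_restrict {a : Cat} {e : Exp K [] a} (σ : Subst K M) {s : Finset TVar}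
    (he : e.FV ⊆ s) : e.substVars (σ.restrict s) = e.substVars σ :=
  e.bind_congr rfl fun x hx => by rw [FMap.restrict_of_mem σ (he hx)]

theorem Exp.substVars_cons_of_notMem {a : Cat} {e : Exp K [] a} (σ : Subst K M) {κ : TVar}
    (w : Val K κ.pol × M) (he : κ ∉ e.FV) :
    e.substVars (FMap.cons σ κ w) = e.substVars σ := by
  rw [Exp.substVars_eq, Subst.value_cons]
  exact e.bind_congr rfl fun x hx =>
    Function.update_of_ne (fun h : x = κ => he (h ▸ hx)) _ _

theorem substVars_toTm {p : Pol} (V : Val K p) (σ : Subst K M) :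
    V.toTm.substVars σ = Val.toTm (V.substVars σ) := by
  cases p <;> rfl

theorem substVars_com {p : Pol} (t : Tm K p) (u : Tm K p.dual) (σ : Subst K M) :
    (com t u).substVars σ = com (t.substVars σ) (u.substVars σ) := by
  cases p <;> rfl

variable [QuantMonoid M]

theorem Subst.weight_cons (σ : Subst K M) {κ : TVar} (hκ : κ ∉ σ.dom) (w : Val K κ.pol × M) :
    Subst.weight (FMap.cons σ κ w) = w.2 + σ.weight := by
  unfold Subst.weight
  rw [FMap.dom_cons, Finset.sum_insert hκ]
  congr 1
  · simp [FMap.cons]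
  · refine Finset.sum_congr rfl fun x hx => ?_
    simp [FMap.cons, ne_of_mem_of_not_mem hx hκ]

theorem Subst.weight_restrict (σ : Subst K M) {s : Finset TVar} (hs : s ⊆ σ.dom) :
    Subst.weight (σ.restrict s) = ∑ x ∈ s, ((σ.toFun x).map Prod.snd).getD 0 := by
  unfold Subst.weight
  rw [FMap.dom_restrict σ hs]
  exact Finset.sum_congr rfl fun x hx => by rw [FMap.restrict_of_mem σ hx]

/-- The quantitative content of context splitting: disjointness ensures that no weight is counted
twice. -/
theorem Subst.weight_eq_add (σ : Subst K M) {s s' : Finset TVar} (h : σ.dom = s ∪ s')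
    (hd : Disjoint s s') :
    σ.weight = Subst.weight (σ.restrict s) + Subst.weight (σ.restrict s') := by
  rw [weight_restrict σ (h ▸ Finset.subset_union_left),
    weight_restrict σ (h ▸ Finset.subset_union_right), ← Finset.sum_union hd, ← h]
  rfl

end Substitutions

/-! ## Orthogonality -/

section Orthogonality

variable {K : Pol → Type u} {M : Type v}

theorem valSet_neg (X : Set (Val K .neg × M)) : valSet X = X :=
  Set.image_id _

theorem valSet_mono {p : Pol} {X Y : Set (Val K p × M)} (h : X ⊆ Y) : valSet X ⊆ valSet Y :=
  Set.image_mono h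

theorem mem_valSet {p : Pol} {X : Set (Val K p × M)} {w : Val K p × M} (h : w ∈ X) :
    (w.1.toTm, w.2) ∈ valSet X :=
  ⟨w, h, rfl⟩

variable [QuantMonoid M]

/-- The set `X` itself for the strict notion of adequacy, its closure under `≤` otherwise. -/
def closureIf (strict : Prop) {p : Pol} (X : Set (Val K p × M)) : Set (Val K p × M) :=
  {w | w ∈ leClosure X ∧ (strict → w ∈ X)}

theorem subset_leClosure {p : Pol} (X : Set (Val K p × M)) : X ⊆ leClosure X :=
  fun w hw => ⟨w.2, le_rfl, hw⟩

theorem leClosure_mono {p : Pol} {X Y : Set (Val K p × M)} (h : X ⊆ Y) :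
    leClosure X ⊆ leClosure Y :=
  fun _ ⟨m, hm, hw⟩ => ⟨m, hm, h hw⟩

theorem subset_closureIf (strict : Prop) {p : Pol} (X : Set (Val K p × M)) :
    X ⊆ closureIf strict X :=
  fun _ hw => ⟨subset_leClosure X hw, fun _ => hw⟩

theorem closureIf_mono {strict : Prop} {p : Pol} {X Y : Set (Val K p × M)} (h : X ⊆ Y) :
    closureIf strict X ⊆ closureIf strict Y :=
  fun _ hw => ⟨leClosure_mono h hw.1, fun hs => h (hw.2 hs)⟩

theorem closureIf_true {p : Pol} (X : Set (Val K p × M)) : closureIf True X = X :=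
  (subset_closureIf True X).antisymm' fun _ hw => hw.2 trivial

theorem closureIf_false {p : Pol} (X : Set (Val K p × M)) : closureIf False X = leClosure X :=
  Set.Subset.antisymm (fun _ hw => hw.1) fun _ hw => ⟨hw, False.elim⟩

/-- Lower bounds for the two weights add up, by compatibility of `≤` with `+`. -/
theorem pair_mem_closureIf {strict : Prop} {p q : Pol} {X : Set (Val K p × M)}
    {Y : Set (Val K q × M)} {v : Val K p × M} {w : Val K q × M} (hv : v ∈ closureIf strict X)
    (hw : w ∈ closureIf strict Y) :
    (.pair v.1 w.1, v.2 + w.2) ∈ closureIf strict (setTensor X Y) := by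
  obtain ⟨⟨m, hm, hmX⟩, hvX⟩ := hv
  obtain ⟨⟨n, hn, hnY⟩, hwY⟩ := hw
  exact ⟨⟨m + n, QuantMonoid.add_le_add' _ _ _ _ hm hn, _, hmX, _, hnY, rfl⟩,
    fun hs => ⟨v, hvX hs, w, hwY hs, rfl⟩⟩

theorem box_mem_closureIf {strict : Prop} {p : Pol} {X : Set (Val K p × M)} {v : Val K p × M}
    (hv : v ∈ closureIf strict X) : (.box v.1, v.2) ∈ closureIf strict (setDown X) := by
  obtain ⟨⟨m, hm, hmX⟩, hvX⟩ := hv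
  exact ⟨⟨m, hm, _, hmX, rfl⟩, fun hs => ⟨v, hvX hs, rfl⟩⟩

namespace QuantPole

variable (S : QuantPole K M)

theorem orth_anti {p : Pol} {X Y : Set (Tm K p × M)} (h : X ⊆ Y) : S.orth Y ⊆ S.orth X :=
  fun _ hw => ⟨hw.1, fun v hv => hw.2 v (h hv)⟩

variable {S}

/-- A description uniform in the polarity: double duality of polarities computes only after a case
split, and commutativity of weights allows the tested term to be written first. -/
theorem mem_biorth {p : Pol} {X : Set (Val K p × M)} {w : Tm K p × M} :
    w ∈ S.biorth X ↔
      w.1.Closed ∧ ∀ v ∈ S.orth (valSet X), (com w.1 v.1, w.2 + v.2) ∈ S.carrier := by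
  simp only [add_comm w.2]
  cases p <;> rfl

theorem biorth_mono {p : Pol} {X Y : Set (Val K p × M)} (h : X ⊆ Y) : S.biorth X ⊆ S.biorth Y :=
  fun _ hw => mem_biorth.2 ⟨(mem_biorth.1 hw).1, fun v hv =>
    (mem_biorth.1 hw).2 v (S.orth_anti (valSet_mono h) hv)⟩

end QuantPole

namespace SaturatedPole

variable {S : SaturatedPole K M}

/-- The inclusion of `X` in its biorthogonal, extended to its closure because the pole is upward
closed in the weight. -/
theorem toTm_mem_biorth {p : Pol} {X : Set (Val K p × M)} {w : Val K p × M} (hc : w.1.Closed)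
    (hw : w ∈ leClosure X) : (w.1.toTm, w.2) ∈ S.biorth X := by
  obtain ⟨m, hm, hmX⟩ := hw
  refine QuantPole.mem_biorth.2 ⟨(Val.FV_toTm _).trans hc, fun v hv => ?_⟩
  exact S.le_sat _ _ _ (QuantMonoid.add_le_add' _ _ _ _ hm le_rfl) (hv.2 _ (mem_valSet hmX))

/-- An orthogonal inherits upward closure from the pole. For this reason `∀` on a negative formula
needs no assumption on the domain. -/
theorem leClosure_orth_subset (X : Set (Tm K .pos × M)) :
    leClosure (p := .neg) (S.orth X) ⊆ S.orth X :=
  fun _ ⟨_, hm, hw⟩ => ⟨hw.1, fun v hv =>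
    S.le_sat _ _ _ (QuantMonoid.add_le_add' _ _ _ _ le_rfl hm) (hw.2 v hv)⟩

end SaturatedPole

end Orthogonality

/-! ### Membership in the interpretations of formulas -/

section Domains

variable {K : Pol → Type u} {M : Type v} [QuantMonoid M] {S : QuantPole K M} {D : PosDomain S}

theorem Sem.closed_of_mem : {p : Pol} → {X : Sem D (.o p)} → {w : Val K p × M} → w ∈ X.set →
    w.1.Closed
  | .pos, X, _, hw => D.closed _ X.2 _ hw
  | .neg, _, _, hw => hw.1

theorem Sem.closed_of_mem_leClosure {p : Pol} {X : Sem D (.o p)} {w : Val K p × M}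
    (hw : w ∈ leClosure X.set) : w.1.Closed :=
  hw.elim fun m h => Sem.closed_of_mem (w := (w.1, m)) h.2

/-- The set of weighted values underlying the orthogonal of `X`. -/
def Sem.coset : {p : Pol} → Sem D (.o p.dual) → Set (Val K p × M)
  | .pos, X => (Sem.perp X).set
  | .neg, X => (Sem.perp X).set

/-- Removes the transport along `Pol.dual_dual` from the definition of adequate substitutions; it
disappears once `p` is known. -/
theorem Form.val_neg_cast {Θ : List Kind} {p : Pol} (A : Form Θ p.dual) (ρ : Valuation D Θ) :
    (show Form Θ p from p.dual_dual ▸ A.neg).val ρ = Sem.coset (A.interp ρ) := by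
  cases p
  · exact congrArg Sem.set (A.interp_neg ρ)
  · exact congrArg Sem.set (A.interp_neg ρ)

theorem Sem.coset_neg {Θ : List Kind} {p : Pol} (A : Form Θ p) (ρ : Valuation D Θ) :
    Sem.coset (A.neg.interp ρ) = A.val ρ := by
  cases p
  · exact congrArg Sem.coset (A.interp_neg ρ)
  · exact congrArg Sem.coset (A.interp_neg ρ)

theorem Sem.closed_of_mem_coset {p : Pol} {X : Sem D (.o p.dual)} {w : Val K p × M}
    (hw : w ∈ Sem.coset X) : w.1.Closed := by
  cases p <;> exact Sem.closed_of_mem hw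

/-- If `X` is positive, `t` lies in the orthogonal of `X^⊥`, and `u` in the biorthogonal of `X^⊥` is
tested against it. If `X` is the orthogonal of a positive `Y`, the roles are exchanged: `u` in the
biorthogonal of `Y` lies in the orthogonal of `X`. -/
theorem com_mem_of_mem_biorth {p : Pol} {X : Sem D (.o p)} {t : Tm K p × M}
    {u : Tm K p.dual × M} (ht : t ∈ S.biorth X.set)
    (hu : u ∈ S.biorth (Sem.set (p := p.dual) (Sem.perp X))) :
    (com t.1 u.1, t.2 + u.2) ∈ S.carrier := by
  cases p with
  | pos =>
    rw [add_comm]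
    refine (QuantPole.mem_biorth.1 hu).2 t ?_
    exact (congrArg (fun Y => t ∈ S.orth (p := .neg) Y) (valSet_neg (S.orth (valSet X.set)))).mpr ht
  | neg =>
    refine (QuantPole.mem_biorth.1 ht).2 u ?_
    rw [valSet_neg]
    exact hu

/-- On negative formulas `∃` is the orthogonal of an intersection, so this is antitonicity of the
orthogonal. -/
theorem Sem.set_subset_ex {σ : Kind} {p : Pol} (F : Sem D σ → Sem D (.o p)) (v : Sem D σ) :
    (F v).set ⊆ (Sem.ex F).set := by
  cases p
  · exact Set.subset_iUnion (fun v => (F v).1) v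
  · exact S.orth_anti (valSet_mono (Set.iInter_subset _ v))

/-- The only place where the closure under `≤` is an obstacle. In the positive case the hypothesis
places `w` in every `F v` itself, not merely in its closure. In the negative case every `F v` is an
orthogonal, hence closed, and the orthogonal of a union is the intersection of the orthogonals. -/
theorem Sem.mem_closureIf_all {S : SaturatedPole K M} {D : PosDomain S.toQuantPole} {σ : Kind}
    {p : Pol} {strict : Prop} (h : p = .pos → strict ∨ D.LeClosed) {F : Sem D σ → Sem D (.o p)}
    {w : Val K p × M} (hw : ∀ v, w ∈ closureIf strict (F v).set) :
    w ∈ closureIf strict (Sem.all F).set := by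
  refine subset_closureIf _ _ ?_
  cases p with
  | pos =>
    refine Set.mem_iInter.2 fun v => ?_
    rcases h rfl with hs | hD
    · exact (hw v).2 hs
    · exact hD _ (F v).2 (hw v).1
  | neg =>
    have hw' v := SaturatedPole.leClosure_orth_subset _ (hw v).1
    -- One instance is needed to know that `w.1` is closed; the test against the union supplies its
    -- own.
    have := Sem.nonempty D σ
    refine ⟨(hw' this.some).1, ?_⟩
    rintro _ ⟨x, hx, rfl⟩
    obtain ⟨v, hv⟩ := Set.mem_iUnion.1 hx
    exact (hw' v).2 _ (mem_valSet hv)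

end Domains

/-! ## Adequate substitutions -/

section AdequateSubst

variable {K : Pol → Type u} {M : Type v} [QuantMonoid M] {S : QuantPole K M} {D : PosDomain S}
  {Θ : List Kind} {ρ : Valuation D Θ} {σ : Subst K M} {Γ : Ctx Θ}

namespace Subst

theorem adequateFor_iff : σ.AdequateFor Γ ρ ↔ σ.dom = Γ.dom ∧ ∀ x A w,
    Γ.toFun x = some A → σ.toFun x = some w → w ∈ Sem.coset (A.interp ρ) := by
  simp only [AdequateFor, Form.val_neg_cast]

theorem AdequateFor.mem_coset (h : σ.AdequateFor Γ ρ) {x : TVar} {A : Form Θ x.pol.dual}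
    {w : Val K x.pol × M} (hA : Γ.toFun x = some A) (hw : σ.toFun x = some w) :
    w ∈ Sem.coset (A.interp ρ) :=
  (adequateFor_iff.1 h).2 x A w hA hw

theorem AdequateFor.cons (h : σ.AdequateFor Γ ρ) {κ : TVar} {A : Form Θ κ.pol.dual}
    {w : Val K κ.pol × M} (hw : w ∈ Sem.coset (A.interp ρ)) :
    Subst.AdequateFor (FMap.cons σ κ w) (FMap.cons Γ κ A) ρ := by
  refine adequateFor_iff.2 ⟨by rw [FMap.dom_cons, FMap.dom_cons, h.1], fun x B v hB hv => ?_⟩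
  by_cases hx : x = κ
  · subst hx
    simp only [FMap.cons, Function.update_self, Option.some.injEq] at hB hv
    exact hB ▸ hv ▸ hw
  · simp only [FMap.cons, Function.update_of_ne hx] at hB hv
    exact h.mem_coset hB hv

theorem AdequateFor.restrict (h : σ.AdequateFor Γ ρ) {Γ' : Ctx Θ}
    (hd : Γ'.dom ⊆ Γ.dom) (hΓ : ∀ x ∈ Γ'.dom, Γ.toFun x = Γ'.toFun x) :
    Subst.AdequateFor (σ.restrict Γ'.dom) Γ' ρ := by
  refine adequateFor_iff.2 ⟨FMap.dom_restrict σ (h.1 ▸ hd), fun x A w hA hw => ?_⟩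
  have hx : x ∈ Γ'.dom := FMap.mem_dom.2 (hA ▸ rfl)
  exact h.mem_coset ((hΓ x hx).trans hA) ((FMap.restrict_of_mem σ hx).symm.trans hw)

/-- A substitution adequate to `κ : A, Γ` consists of a value for `κ` and of a substitution
adequate to `Γ`. -/
theorem AdequateFor.exists_eq_cons {κ : TVar} {A : Form Θ κ.pol.dual} (hκ : κ ∉ Γ.dom)
    (h : σ.AdequateFor (FMap.cons Γ κ A) ρ) :
    ∃ (τ : Subst K M) (w : Val K κ.pol × M), σ = FMap.cons τ κ w ∧ τ.AdequateFor Γ ρ ∧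
      w ∈ Sem.coset (A.interp ρ) := by
  obtain ⟨w, hw, hσ⟩ := FMap.exists_eq_cons_restrict (h.1.trans (FMap.dom_cons Γ κ A))
  refine ⟨_, w, hσ, h.restrict ?_ fun x hx => ?_, h.mem_coset ?_ hw⟩
  · rw [FMap.dom_cons]
    exact Finset.subset_insert _ _
  · simp [FMap.cons, ne_of_mem_of_not_mem hx hκ]
  · simp [FMap.cons]

theorem AdequateFor.restrict_left {Γ' : Ctx Θ} (h : σ.AdequateFor (Γ.union Γ') ρ) :
    Subst.AdequateFor (σ.restrict Γ.dom) Γ ρ := by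
  refine h.restrict (by rw [FMap.dom_union]; exact Finset.subset_union_left) fun x hx => ?_
  obtain ⟨A, hA⟩ := Option.isSome_iff_exists.1 (FMap.mem_dom.1 hx)
  simp [FMap.union, hA]

/-- Unlike on the left, disjointness matters here: `FMap.union` gives priority to its left argument.
-/
theorem AdequateFor.restrict_right {Γ' : Ctx Θ} (hd : Disjoint Γ.dom Γ'.dom)
    (h : σ.AdequateFor (Γ.union Γ') ρ) : Subst.AdequateFor (σ.restrict Γ'.dom) Γ' ρ := by
  refine h.restrict (by rw [FMap.dom_union]; exact Finset.subset_union_right) fun x hx => ?_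
  have : Γ.toFun x = none := by
    simpa [FMap.mem_dom] using Finset.disjoint_right.1 hd hx
  simp [FMap.union, this]

theorem AdequateFor.weight_eq_add {Γ' : Ctx Θ} (hd : Disjoint Γ.dom Γ'.dom)
    (h : σ.AdequateFor (Γ.union Γ') ρ) :
    σ.weight = Subst.weight (σ.restrict Γ.dom) + Subst.weight (σ.restrict Γ'.dom) :=
  Subst.weight_eq_add σ (h.1.trans (FMap.dom_union _ _)) hd

/-- Elements of interpretations are closed, so a scoped expression has all its free variables
replaced by closed values. -/
theorem AdequateFor.closed_substVars (h : σ.AdequateFor Γ ρ) {a : Cat} {e : Exp K [] a}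
    (he : e.FV ⊆ Γ.dom) : (e.substVars σ).Closed := by
  refine Set.subset_empty_iff.1 (e.FV_bind_subset (fun _ i => nomatch i) fun x hx => ?_)
  have hx' : x ∈ Γ.dom := he hx
  obtain ⟨A, hA⟩ := Option.isSome_iff_exists.1 (FMap.mem_dom.1 hx')
  obtain ⟨w, hw⟩ := Option.isSome_iff_exists.1 (FMap.mem_dom.1 (h.1.symm ▸ hx'))
  rw [hw]
  exact (Sem.closed_of_mem_coset (h.mem_coset hA hw)).subset

/-- Semantic form of the eigenvariable condition of `∀`: one substitution serves all values of the
new constructor variable. -/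
theorem AdequateFor.wk (h : σ.AdequateFor Γ ρ) {τ : Kind} (v : Sem D τ) :
    σ.AdequateFor (Ctx.wk Γ) (ρ.cons v) := by
  refine adequateFor_iff.2 ⟨h.1.trans (FMap.dom_map _ _).symm, fun x A w hA hw => ?_⟩
  obtain ⟨B, hB, rfl⟩ := Option.map_eq_some_iff.1 hA
  rw [Con.interp_wk]
  exact h.mem_coset hB hw

end Subst

end AdequateSubst

/-! ## Derivable judgments are scoped -/

theorem Exp.FV_close_subset_dom {K : Pol → Type u} {Θ : List Kind} {κ : TVar} {c : Cmd K}
    {A : Form Θ κ.pol.dual} {Γ : Ctx Θ} (h : c.FV ⊆ (FMap.cons Γ κ A).dom) :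
    (c.close κ).FV ⊆ Γ.dom :=
  c.FV_close_subset κ (by simpa [FMap.dom_cons] using h)

/-- Scoping is not built into judgments. It holds for the axioms and is preserved by the other
rules, so derivations may use it freely. -/
theorem Rule.scoped {K : Pol → Type u} {R : RuleName} {J : Fin R.arity → Judgment K}
    {L : Judgment K} (h : Rule R J L) (hJ : ∀ i, (J i).Scoped) : L.Scoped := by
  cases h with
  | axPos n P =>
    refine Set.singleton_subset_iff.2 ?_
    simp [FMap.dom_cons]
  | axNeg n N =>
    refine Set.singleton_subset_iff.2 ?_
    simp [FMap.dom_cons]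
  | muPos n c P Γ hn =>
    exact Exp.FV_close_subset_dom (hJ (0 : Fin 1))
  | muNeg n c N Γ hn =>
    exact Exp.FV_close_subset_dom (hJ (0 : Fin 1))
  | cut t u A Γ Γ' hd =>
    have h₀ : t.FV ⊆ Γ.dom := hJ (0 : Fin 2)
    have h₁ : u.FV ⊆ Γ'.dom := hJ (1 : Fin 2)
    simpa [Judgment.Scoped, FV_com, FMap.dom_union] using
      ⟨h₀.trans Set.subset_union_left, h₁.trans Set.subset_union_right⟩
  | tensor V V' A B Γ Γ' hd =>
    have h₀ : V.toTm.FV ⊆ Γ.dom := hJ (0 : Fin 2)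
    have h₁ : V'.toTm.FV ⊆ Γ'.dom := hJ (1 : Fin 2)
    rw [Val.FV_toTm] at h₀ h₁
    simpa [Judgment.Scoped, Exp.FV, FMap.dom_union] using
      ⟨h₀.trans Set.subset_union_left, h₁.trans Set.subset_union_right⟩
  | par κ κ' c A B Γ hne hκ hκ' =>
    have h₀ : c.FV ⊆ (FMap.cons (FMap.cons Γ κ' B) κ A).dom := hJ (0 : Fin 1)
    rw [FMap.dom_cons, FMap.dom_cons, Finset.coe_insert, Finset.coe_insert] at h₀
    exact Exp.FV_close₂_subset _ _ _ h₀
  | down V A Γ =>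
    have h₀ : V.toTm.FV ⊆ Γ.dom := hJ (0 : Fin 1)
    exact (Val.FV_toTm V).symm.trans_subset h₀
  | up κ c A Γ hκ =>
    exact Exp.FV_close_subset_dom (hJ (0 : Fin 1))
  | ex T t A Γ => exact hJ (0 : Fin 1)
  | all V A Γ =>
    have h₀ : V.toTm.FV ⊆ (Ctx.wk Γ).dom := hJ (0 : Fin 1)
    rwa [Ctx.wk, FMap.dom_map] at h₀
  | conv κ c A B Γ hκ hAB =>
    have h₀ : c.FV ⊆ (FMap.cons Γ κ A).dom := hJ (0 : Fin 1)
    simpa [Judgment.Scoped, FMap.dom_cons] using h₀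
  | weak κ c A Γ hκ =>
    have h₀ : c.FV ⊆ Γ.dom := hJ (0 : Fin 1)
    simpa [Judgment.Scoped, FMap.dom_cons] using h₀.trans (Set.subset_insert κ _)

theorem Deriv.scoped {K : Pol → Type u} {L : Judgment K} (π : Deriv L) : L.Scoped := by
  induction π with
  | step R J L h π ih => exact h.scoped ih

/-! ## Adequacy of the rules -/

section Adequacy

variable {K : Pol → Type u} {M : Type v} [QuantMonoid M]

/-- `p`-adequacy, in the strict sense or not according to `strict`. -/
def Judgment.AdequateIf {S : QuantPole K M} (D : PosDomain S) (strict : Prop) (m : M) :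
    Judgment K → Prop
  | .cmd Θ c Γ => ∀ (ρ : Valuation D Θ) (σ : Subst K M), σ.AdequateFor Γ ρ →
      (c.substVars σ, m + σ.weight) ∈ S.carrier
  | .tm Θ _ t B Γ => ∀ (ρ : Valuation D Θ) (σ : Subst K M), σ.AdequateFor Γ ρ →
      (t.substVars σ, m + σ.weight) ∈ S.biorth (B.val ρ) ∧
      ∀ V : Val K _, t = V.toTm →
        (V.substVars σ, m + σ.weight) ∈ closureIf strict (B.val ρ)

theorem Judgment.adequateIf_false {S : QuantPole K M} {D : PosDomain S} {m : M}
    {J : Judgment K} : J.AdequateIf D False m ↔ J.Adequate D m := by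
  cases J
  · rfl
  · simp only [AdequateIf, Adequate, closureIf_false]

theorem Judgment.adequateIf_true {S : QuantPole K M} {D : PosDomain S} {m : M}
    {J : Judgment K} : J.AdequateIf D True m ↔ J.StrictlyAdequate D m := by
  cases J
  · rfl
  · simp only [AdequateIf, StrictlyAdequate, closureIf_true]

/-- Strict adequacy implies adequacy. -/
theorem Judgment.StrictlyAdequate.adequate {S : QuantPole K M} {D : PosDomain S} {m : M}
    {J : Judgment K} (h : J.StrictlyAdequate D m) : J.Adequate D m := by
  cases J with
  | cmd => exact h
  | tm => exact fun ρ σ hσ =>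
      ⟨(h ρ σ hσ).1, fun V hV => subset_leClosure _ ((h ρ σ hσ).2 V hV)⟩

variable {S : SaturatedPole K M} {D : PosDomain S.toQuantPole} {strict : Prop} {m m' : M}
  {Θ : List Kind} {Γ Γ' : Ctx Θ}

namespace Judgment

/-- Adequacy of a value follows from its membership in the interpretation of its type. -/
theorem adequateIf_toTm {p : Pol} {V : Val K p} {B : Form Θ p}
    (h : ∀ (ρ : Valuation D Θ) (σ : Subst K M), σ.AdequateFor Γ ρ →
      (V.substVars σ, m + σ.weight) ∈ closureIf strict (B.val ρ)) :
    (Judgment.tm Θ p V.toTm B Γ).AdequateIf D strict m := by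
  refine fun ρ σ hσ => ⟨?_, fun V' hV => Val.toTm_injective hV ▸ h ρ σ hσ⟩
  have hw := (h ρ σ hσ).1
  rw [substVars_toTm]
  exact SaturatedPole.toTm_mem_biorth (Sem.closed_of_mem_leClosure hw) hw

theorem AdequateIf.mem_of_toTm {p : Pol} {V : Val K p} {B : Form Θ p}
    (h : (Judgment.tm Θ p V.toTm B Γ).AdequateIf D strict m) {ρ : Valuation D Θ}
    {σ : Subst K M} (hσ : σ.AdequateFor Γ ρ) :
    (V.substVars σ, m + σ.weight) ∈ closureIf strict (B.val ρ) :=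
  (h ρ σ hσ).2 V rfl

/-- A command that is adequate in the context `κ : A, Γ` is in the pole once a value
orthogonal to `A` is substituted for `κ`. -/
theorem AdequateIf.subst_cons {κ : TVar} {c : Cmd K} {A : Form Θ κ.pol.dual}
    (h : (Judgment.cmd Θ c (FMap.cons Γ κ A)).AdequateIf D strict m) (hκ : κ ∉ Γ.dom)
    {ρ : Valuation D Θ} {σ : Subst K M} (hσ : σ.AdequateFor Γ ρ) {w : Val K κ.pol × M}
    (hw : w ∈ Sem.coset (A.interp ρ)) :
    (((c.close κ).bind (liftB noB) (liftF σ.value)).inst w.1, m + σ.weight + w.2) ∈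
      S.carrier := by
  have := h ρ _ (hσ.cons hw)
  -- Read backwards, `Exp.inst_close` exhibits the substituted premise as the reduct of a cut.
  rw [Exp.substVars_eq, Subst.value_cons, ← Exp.inst_close,
    Subst.weight_cons σ (hσ.1 ▸ hκ)] at this
  rwa [add_assoc, add_comm σ.weight]

/-- The same for two variables, in the form of the reduct of a `β` step on a pair. -/
theorem AdequateIf.subst_cons_cons {κ κ' : TVar} {c : Cmd K} {A : Form Θ κ.pol.dual}
    {B : Form Θ κ'.pol.dual}
    (h : (Judgment.cmd Θ c (FMap.cons (FMap.cons Γ κ' B) κ A)).AdequateIf D strict m)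
    (hne : κ ≠ κ') (hκ : κ ∉ Γ.dom) (hκ' : κ' ∉ Γ.dom)
    {ρ : Valuation D Θ} {σ : Subst K M} (hσ : σ.AdequateFor Γ ρ) {w : Val K κ.pol × M}
    {w' : Val K κ'.pol × M} (hw : w ∈ Sem.coset (A.interp ρ))
    (hw' : w' ∈ Sem.coset (B.interp ρ)) :
    (((c.close₂ κ κ').bind (liftB (liftB noB)) (liftF (liftF σ.value))).inst₂ w.1 w'.1,
      m + σ.weight + (w.2 + w'.2)) ∈ S.carrier := by
  have := h ρ _ ((hσ.cons hw').cons hw)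
  rw [Exp.substVars_eq, Subst.value_cons, Subst.value_cons, ← Exp.inst₂_close₂ hne,
    Subst.weight_cons _ (by simp [FMap.dom_cons, hσ.1, hne, hκ]),
    Subst.weight_cons σ (hσ.1 ▸ hκ')] at this
  rwa [add_assoc, add_comm σ.weight, add_assoc]

end Judgment

/-! ### Adequacy of the individual typing rules -/

theorem cut_closed {t : Tm K .pos} {u : Tm K .neg} (ht : t.Closed) (hu : u.Closed) :
    (Exp.cut t u).Closed :=
  Set.union_empty_iff.2 ⟨ht, hu⟩

/-- Against an element of the orthogonal of `P` the term makes a `μ` step to the premise. It is not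
a value, so the clause on values is void. -/
theorem adequateIf_muPos {n : ℕ} {c : Cmd K} {P : Form Θ .pos} (hn : ⟨.neg, n⟩ ∉ Γ.dom)
    (hc : Exp.FV (.muPos (c.close ⟨.neg, n⟩)) ⊆ Γ.dom)
    (h : (Judgment.cmd Θ c (FMap.cons Γ ⟨.neg, n⟩ P)).AdequateIf D strict m) :
    (Judgment.tm Θ .pos (.muPos (c.close ⟨.neg, n⟩)) P Γ).AdequateIf D strict m := by
  refine fun ρ σ hσ => ⟨QuantPole.mem_biorth.2 ⟨hσ.closed_substVars hc, fun v hv => ?_⟩,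
    fun V hV => nomatch hV⟩
  exact (S.mu_sat _ _ _ (cut_closed (hσ.closed_substVars hc) hv.1) (.pos _ _)).1
    (h.subst_cons hn hσ hv)

/-- A negative term is a value and its type is interpreted by an orthogonal, so testing against the
positive values of `N^⊥` gives membership in the set itself, and both clauses follow. -/
theorem adequateIf_muNeg {n : ℕ} {c : Cmd K} {N : Form Θ .neg} (hn : ⟨.pos, n⟩ ∉ Γ.dom)
    (hc : Exp.FV (.muNeg (c.close ⟨.pos, n⟩)) ⊆ Γ.dom)
    (h : (Judgment.cmd Θ c (FMap.cons Γ ⟨.pos, n⟩ N)).AdequateIf D strict m) :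
    (Judgment.tm Θ .neg (.muNeg (c.close ⟨.pos, n⟩)) N Γ).AdequateIf D strict m := by
  refine Judgment.adequateIf_toTm fun ρ σ hσ => subset_closureIf _ _
    ⟨hσ.closed_substVars hc, ?_⟩
  rintro _ ⟨v, hv, rfl⟩
  show (_, v.2 + (m + σ.weight)) ∈ S.carrier
  rw [add_comm v.2]
  exact (S.mu_sat _ _ _ (cut_closed (Sem.closed_of_mem_coset (p := .pos) hv)
    (hσ.closed_substVars hc)) (.neg _ _)).1 (h.subst_cons hn hσ hv)

theorem adequateIf_cut {p : Pol} {t : Tm K p} {u : Tm K p.dual} {A : Form Θ p}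
    (hd : Disjoint Γ.dom Γ'.dom) (ht : t.FV ⊆ Γ.dom) (hu : u.FV ⊆ Γ'.dom)
    (h : (Judgment.tm Θ p t A Γ).AdequateIf D strict m)
    (h' : (Judgment.tm Θ p.dual u A.neg Γ').AdequateIf D strict m') :
    (Judgment.cmd Θ (com t u) (Γ.union Γ')).AdequateIf D strict (m + m') := by
  intro ρ σ hσ
  have ht' := (h ρ _ hσ.restrict_left).1
  have hu' := (h' ρ _ (hσ.restrict_right hd)).1
  rw [Exp.substVars_restrict σ ht] at ht'
  rw [Exp.substVars_restrict σ hu] at hu'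
  -- Replaces the interpretation of the negation by the orthogonal of the interpretation.
  replace hu' := (congrArg (fun X : Sem D (.o p.dual) => _ ∈ S.biorth X.set)
    (A.interp_neg ρ)).mp hu'
  rw [hσ.weight_eq_add hd, add_add_add_comm, substVars_com]
  exact com_mem_of_mem_biorth ht' hu'

/-- The value clauses of the premises carry the argument: biorthogonals alone would not say that the
components lie in the interpretations. -/
theorem adequateIf_tensor {p q : Pol} {V : Val K p} {V' : Val K q} {A : Form Θ p}
    {B : Form Θ q} (hd : Disjoint Γ.dom Γ'.dom) (hV : V.toTm.FV ⊆ Γ.dom)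
    (hV' : V'.toTm.FV ⊆ Γ'.dom) (h : (Judgment.tm Θ p V.toTm A Γ).AdequateIf D strict m)
    (h' : (Judgment.tm Θ q V'.toTm B Γ').AdequateIf D strict m') :
    (Judgment.tm Θ .pos (.ret (.pair V V')) (.tensor A B) (Γ.union Γ')).AdequateIf D strict
      (m + m') := by
  refine Judgment.adequateIf_toTm (V := .pair V V') fun ρ σ hσ => ?_
  have hw := h.mem_of_toTm hσ.restrict_left
  have hw' := h'.mem_of_toTm (hσ.restrict_right hd)
  rw [Val.FV_toTm] at hV hV'
  rw [Exp.substVars_restrict σ hV] at hw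
  rw [Exp.substVars_restrict σ hV'] at hw'
  rw [hσ.weight_eq_add hd, add_add_add_comm]
  exact pair_mem_closureIf hw hw'

theorem adequateIf_par {κ κ' : TVar} {c : Cmd K} {A : Form Θ κ.pol.dual}
    {B : Form Θ κ'.pol.dual} (hne : κ ≠ κ') (hκ : κ ∉ Γ.dom) (hκ' : κ' ∉ Γ.dom)
    (hc : Exp.FV (.muPair (c.close₂ κ κ')) ⊆ Γ.dom)
    (h : (Judgment.cmd Θ c (FMap.cons (FMap.cons Γ κ' B) κ A)).AdequateIf D strict m) :
    (Judgment.tm Θ .neg (.muPair (c.close₂ κ κ')) (.par A B) Γ).AdequateIf D strict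
      (m + S.pβ) := by
  refine Judgment.adequateIf_toTm fun ρ σ hσ => subset_closureIf _ _
    ⟨hσ.closed_substVars hc, ?_⟩
  obtain ⟨p, n⟩ := κ
  obtain ⟨q, n'⟩ := κ'
  -- Once the polarities are known, the orthogonals in `Sem.par` are definitionally the sets
  -- required of the substituted values.
  cases p <;> cases q <;>
  · rintro _ ⟨_, ⟨v, hv, v', hv', rfl⟩, rfl⟩
    have e : v.2 + v'.2 + (m + S.pβ + σ.weight) = m + σ.weight + (v.2 + v'.2) + S.pβ := by abel
    refine (congrArg (fun x => (_, x) ∈ S.carrier) e).mpr (S.beta_sat _ _ _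
      (cut_closed (t := .ret (.pair v.1 v'.1)) ?_ (hσ.closed_substVars hc)) (.par _ _ _)
      (h.subst_cons_cons hne hκ hκ' hσ hv hv'))
    exact Set.union_empty_iff.2 ⟨Sem.closed_of_mem hv, Sem.closed_of_mem hv'⟩

theorem adequateIf_down {p : Pol} {V : Val K p} {A : Form Θ p}
    (h : (Judgment.tm Θ p V.toTm A Γ).AdequateIf D strict m) :
    (Judgment.tm Θ .pos (.ret (.box V)) (.down A) Γ).AdequateIf D strict m :=
  Judgment.adequateIf_toTm (V := .box V) fun _ _ hσ => box_mem_closureIf (h.mem_of_toTm hσ)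

theorem adequateIf_up {κ : TVar} {c : Cmd K} {A : Form Θ κ.pol.dual} (hκ : κ ∉ Γ.dom)
    (hc : Exp.FV (.muBox (c.close κ)) ⊆ Γ.dom)
    (h : (Judgment.cmd Θ c (FMap.cons Γ κ A)).AdequateIf D strict m) :
    (Judgment.tm Θ .neg (.muBox (c.close κ)) (.up A) Γ).AdequateIf D strict (m + S.pβ) := by
  refine Judgment.adequateIf_toTm fun ρ σ hσ => subset_closureIf _ _
    ⟨hσ.closed_substVars hc, ?_⟩
  obtain ⟨p, n⟩ := κ
  cases p <;>
  · rintro _ ⟨_, ⟨v, hv, rfl⟩, rfl⟩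
    have e : v.2 + (m + S.pβ + σ.weight) = m + σ.weight + v.2 + S.pβ := by abel
    refine (congrArg (fun x => (_, x) ∈ S.carrier) e).mpr (S.beta_sat _ _ _
      (cut_closed (t := .ret (.box v.1)) ?_ (hσ.closed_substVars hc)) (.up _ _)
      (h.subst_cons hκ hσ hv))
    exact Sem.closed_of_mem (w := v) hv

/-- The interpretation of `A[T/x]` is the instance of the family at the interpretation of `T`;
biorthogonals and closures are monotone. -/
theorem adequateIf_ex {p : Pol} {τ : Kind} {T : Con Θ τ} {t : Tm K p} {A : Form (τ :: Θ) p}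
    (h : (Judgment.tm Θ p t (A.subst₀ T) Γ).AdequateIf D strict m) :
    (Judgment.tm Θ p t (.ex τ A) Γ).AdequateIf D strict m := by
  intro ρ σ hσ
  have hA : Form.val (A.subst₀ T) ρ ⊆ Form.val (.ex τ A : Form Θ p) ρ := by
    rw [Form.val, Con.interp_subst₀]
    exact Sem.set_subset_ex (fun v => A.interp (ρ.cons v)) (T.interp ρ)
  exact ⟨QuantPole.biorth_mono hA (h ρ σ hσ).1,
    fun V hV => closureIf_mono hA ((h ρ σ hσ).2 V hV)⟩

/-- The value restriction is essential to the argument: only the value clause of the premise is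
used, for the same weighted value at every instance `v`. -/
theorem adequateIf_all {p : Pol} {τ : Kind} {V : Val K p} {A : Form (τ :: Θ) p}
    (hp : p = .pos → strict ∨ D.LeClosed)
    (h : (Judgment.tm (τ :: Θ) p V.toTm A (Ctx.wk Γ)).AdequateIf D strict m) :
    (Judgment.tm Θ p V.toTm (.all τ A) Γ).AdequateIf D strict m :=
  Judgment.adequateIf_toTm fun _ _ hσ =>
    Sem.mem_closureIf_all hp fun v => h.mem_of_toTm (hσ.wk v)

theorem adequateIf_conv {κ : TVar} {c : Cmd K} {A B : Form Θ κ.pol.dual} (hκ : κ ∉ Γ.dom)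
    (hAB : Conv A B) (h : (Judgment.cmd Θ c (FMap.cons Γ κ A)).AdequateIf D strict m) :
    (Judgment.cmd Θ c (FMap.cons Γ κ B)).AdequateIf D strict m := by
  intro ρ σ hσ
  obtain ⟨τ, w, rfl, hτ, hw⟩ := hσ.exists_eq_cons hκ
  exact h ρ _ (hτ.cons (hAB.interp_eq ρ ▸ hw))

theorem adequateIf_weak {κ : TVar} {c : Cmd K} {A : Form Θ κ.pol.dual} (hκ : κ ∉ Γ.dom)
    (hc : c.FV ⊆ Γ.dom) (h : (Judgment.cmd Θ c Γ).AdequateIf D strict m) :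
    (Judgment.cmd Θ c (FMap.cons Γ κ A)).AdequateIf D strict m := by
  intro ρ σ hσ
  obtain ⟨τ, w, rfl, hτ, hw⟩ := hσ.exists_eq_cons hκ
  rw [Exp.substVars_cons_of_notMem τ w fun h => hκ (hc h), Subst.weight_cons τ (hτ.1 ▸ hκ)]
  -- The discarded value still contributes its weight, which is nonnegative and is absorbed by
  -- upward closure of the pole.
  refine S.le_sat _ _ _ (QuantMonoid.add_le_add' _ _ _ _ le_rfl ?_) (h ρ τ hτ)
  simpa using QuantMonoid.add_le_add' _ _ _ _ (QuantMonoid.zero_le' w.2) (le_refl τ.weight)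

/-- A substitution adequate to the one declaration supplies an element of the orthogonal of `A^⊥`,
that is, of `A` itself; its weight is the whole weight. -/
theorem adequateIf_var {p : Pol} {n : ℕ} {A : Form Θ p}
    (B : Form Θ (TVar.mk p n).pol.dual) (hB : B = A.neg) :
    (Judgment.tm Θ p (Val.toTm (fv ⟨p, n⟩)) A (FMap.empty.cons ⟨p, n⟩ B)).AdequateIf D
      strict 0 := by
  subst hB
  refine Judgment.adequateIf_toTm fun ρ σ hσ => subset_closureIf _ _ ?_
  obtain ⟨τ, w, rfl, hτ, hw⟩ := hσ.exists_eq_cons (by simp [FMap.dom_empty])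
  have hτ' : τ.dom = ∅ := hτ.1.trans FMap.dom_empty
  rw [Subst.weight_cons τ (by simp [hτ']), Subst.weight, hτ', Finset.sum_empty, add_zero,
    zero_add, Exp.substVars_eq, Subst.value_cons]
  rw [Sem.coset_neg] at hw
  simpa [fv, Exp.bind] using hw

/-- Every rule is adequate, in the strict sense or not. -/
theorem Rule.adequateIf {R : RuleName} {J : Fin R.arity → Judgment K} {L : Judgment K}
    (h : Rule R J L) (hJ : ∀ i, (J i).Scoped)
    (hall : R = .all → L.OnPositive → strict ∨ D.LeClosed) (x : Fin R.arity → M)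
    (hx : ∀ i, (J i).AdequateIf D strict (x i)) : L.AdequateIf D strict (cost S.pβ R x) := by
  -- Supplies the closedness of the substituted abstractions, which saturation requires.
  have hL := h.scoped hJ
  cases h with
  | axPos n P => exact adequateIf_var (p := .pos) _ rfl
  | axNeg n N => exact adequateIf_var (p := .neg) _ rfl
  | muPos n c P Γ hn => exact adequateIf_muPos hn hL (hx (0 : Fin 1))
  | muNeg n c N Γ hn => exact adequateIf_muNeg hn hL (hx (0 : Fin 1))
  | cut t u A Γ Γ' hd =>
    exact adequateIf_cut hd (hJ (0 : Fin 2)) (hJ (1 : Fin 2)) (hx (0 : Fin 2)) (hx (1 : Fin 2))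
  | tensor V V' A B Γ Γ' hd =>
    exact adequateIf_tensor hd (hJ (0 : Fin 2)) (hJ (1 : Fin 2)) (hx (0 : Fin 2))
      (hx (1 : Fin 2))
  | par κ κ' c A B Γ hne hκ hκ' => exact adequateIf_par hne hκ hκ' hL (hx (0 : Fin 1))
  | down V A Γ => exact adequateIf_down (hx (0 : Fin 1))
  | up κ c A Γ hκ => exact adequateIf_up hκ hL (hx (0 : Fin 1))
  | ex T t A Γ => exact adequateIf_ex (hx (0 : Fin 1))
  | all V A Γ => exact adequateIf_all (hall rfl) (hx (0 : Fin 1))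
  | conv κ c A B Γ hκ hAB => exact adequateIf_conv hκ hAB (hx (0 : Fin 1))
  | weak κ c A Γ hκ => exact adequateIf_weak hκ (hJ (0 : Fin 1)) (hx (0 : Fin 1))

theorem Rule.strictlyAdequate {R : RuleName} {J : Fin R.arity → Judgment K} {L : Judgment K}
    (h : Rule R J L) (hJ : ∀ i, (J i).Scoped) (x : Fin R.arity → M)
    (hx : ∀ i, (J i).StrictlyAdequate D (x i)) : L.StrictlyAdequate D (MALomega.cost S.pβ R x) :=
  Judgment.adequateIf_true.1 <| h.adequateIf hJ (fun _ _ => Or.inl trivial) x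
    fun i => Judgment.adequateIf_true.2 (hx i)

/-- The induction is on the strict notion, because the step for positive `∀` then needs no closure
assumption on the domain. -/
theorem Deriv.strictlyAdequate (D : PosDomain S.toQuantPole) {L : Judgment K} (π : Deriv L) :
    L.StrictlyAdequate D (π.cost S.pβ) := by
  induction π with
  | step R J L h π ih => exact h.strictlyAdequate (fun i => (π i).scoped) _ ih

end Adequacy

end MALomega

open MALomega in
theorem mainTheorem1 {K : Pol → Type u} {M : Type v} [QuantMonoid M]
    (S : SaturatedPole K M) (D : PosDomain S.toQuantPole) :
    -- every rule is adequate; for `∀` on a positive formula, if the domain is closed under `≤`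
    (∀ (R : RuleName) (J : Fin R.arity → Judgment K) (L : Judgment K), Rule R J L →
      (∀ i, (J i).Scoped) → (R = .all → L.OnPositive → D.LeClosed) →
      ∀ m : Fin R.arity → M, (∀ i, (J i).Adequate D (m i)) → L.Adequate D (cost S.pβ R m)) ∧
    -- every rule without exception is strictly adequate
    (∀ (R : RuleName) (J : Fin R.arity → Judgment K) (L : Judgment K), Rule R J L →
      (∀ i, (J i).Scoped) →
      ∀ m : Fin R.arity → M, (∀ i, (J i).StrictlyAdequate D (m i)) →
        L.StrictlyAdequate D (cost S.pβ R m)) ∧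
    -- the conclusion of every derivation is adequate, and even strictly adequate
    (∀ (L : Judgment K) (π : Deriv L),
      L.Adequate D (π.cost S.pβ) ∧ L.StrictlyAdequate D (π.cost S.pβ)) := by
  refine ⟨fun R J L h hJ hall x hx => ?_, fun R J L h hJ x hx => h.strictlyAdequate hJ x hx,
    fun L π => ⟨(π.strictlyAdequate D).adequate, π.strictlyAdequate D⟩⟩
  exact Judgment.adequateIf_false.1 <| h.adequateIf hJ (fun hR hL => Or.inr (hall hR hL)) x
    fun i => Judgment.adequateIf_false.2 (hx i)
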